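/- Let $T$ be the infinite binary rooted tree, whose vertices are the finite words over $\{0,1\}$. For $m\ge 0$ let $\mathrm{Stab}(m)\le\mathrm{Aut}\,T$ be the fixator of the $m$-th level, and for $G\le\mathrm{Aut}\,T$ write $G \bmod m=G/(G\cap\mathrm{Stab}(m))$. Equip $\mathrm{Aut}\,T$ with the metric $d(g,h)=\inf\{\,|\mathrm{Aut}\,T \bmod m|^{-1} : g^{-1}h\in\mathrm{Stab}(m)\}$, where $|\mathrm{Aut}\,T \bmod m|=2^{2^m-1}$, and let $\dim_H G$ denote the Hausdorff dimension of the closure of $G$ in this metric. Let $B=C_2^d$, viewed as a vector space over $\mathbb{F}_2$, and let $\omega$ be an infinite sequence of non-trivial elements $\omega_{(1)},\omega_{(2)},\dots$ of the dual space $B^*$. Let $a$ act on $T$ by exchanging the two maximal subtrees, and let $b\in B$ act by $b=\langle \omega_{(1)}(b), b_1\rangle$, $b_k=\langle\omega_{(k+1)}(b),b_{k+1}\rangle$ for $k\ge1$, where $\langle g_0,g_1\rangle$ acts as $g_x$ on the subtree below the vertex $x\in\{0,1\}$, and the non-zero element of $\mathbb{F}_2$ acts as $a$. The spinal group $G_\omega\le\mathrm{Aut}\,T$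 is the group generated by $a$ and $B$. Let $\sigma$ be the shift on sequences, let $\dim(\omega \bmod m)$ be the dimension of the span of the first $m-1$ terms of $\omega$, and put $\operatorname{diminf}(\omega)=\liminf_{l\to\infty}\lim_{m\to\infty}\dim(\sigma^l\omega\bmod m)$. Suppose that $\operatorname{diminf}(\omega)=n\ge 2$, and let $\omega=\omega_1^{a_1}\omega_2^{a_2}\cdots$ be in syllable form, i.e. $a_i\ge1$ and $\omega_i\ne\omega_{i+1}$ for all $i\ge1$. Put $s_k=a_1+\dots+a_k$ and $\Sigma_k=\sum_{j=1}^k2^{s_{j-1}}a_j$, and for $2\le i\le n-1$ let $\lambda_i=\lambda_i(k)$ be the smallest integer $\lambda\ge 0$ such that $$\dim\bigl(\sigma^{s_\lambda}\omega \bmod (s_k+1-s_\lambda)\bigr)=i,$$ i.e. such that $\omega_{\lambda+1},\dots,\omega_k$ span a space of dimension $i$ (it exists for all large $k$). Then $$\dim_H G_\omega=\liminf_{m\to\infty}\frac{\log_2|G_\omega\bmod m|}{2^m}=\frac12\liminf_{k\to\infty}\left(\frac{\Sigma_k}{2^{s_k}}+\frac1{2^{s_k}}\sum_{i=2}^{n-1}2^{s_{\lambda_i}}\left(2-\frac1{2^{a_{\lambda_i}}}\right)+\frac1{2^{a_k}}\left(1-\frac1{2^{a_{k-1}}}\right)\right).$$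 -/

import Mathlib

open Filter

/-! ### The binary rooted tree and its automorphism group

Vertices are the finite words over `{0, 1}`, with `false` for `0` and `true` for `1`; the word `u`
is an ancestor of `v` iff it is a prefix of `v`. -/

/-- The automorphisms of the rooted binary tree, as a group of permutations of the vertices: they
preserve the levels and the ancestor relation. -/
def treeAutSubgroup : Subgroup (Equiv.Perm (List Bool)) where
  carrier := {g | (∀ v, (g v).length = v.length) ∧ ∀ u v, g u <+: g v ↔ u <+: v}
  one_mem' := ⟨fun _ => rfl, fun _ _ => Iff.rfl⟩
  mul_mem' := by
    rintro g h ⟨hg, hg'⟩ ⟨hh, hh'⟩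
    exact ⟨fun v => by rw [Equiv.Perm.mul_apply, hg, hh],
      fun u v => by rw [Equiv.Perm.mul_apply, Equiv.Perm.mul_apply, hg', hh']⟩
  inv_mem' := by
    rintro g ⟨hg, hg'⟩
    refine ⟨fun v => ?_, fun u v => ?_⟩
    · rw [← hg (g⁻¹ v)]; simp
    · rw [← hg' (g⁻¹ u) (g⁻¹ v)]; simp

/-- The automorphism group of the binary rooted tree. -/
def TreeAut : Type := treeAutSubgroup

namespace TreeAut

instance : Group TreeAut := inferInstanceAs (Group treeAutSubgroup)

/-- The underlying permutation of the vertices. -/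
def toPerm : TreeAut →* Equiv.Perm (List Bool) := treeAutSubgroup.subtype

theorem toPerm_injective : Function.Injective toPerm := Subtype.val_injective

theorem length_toPerm (g : TreeAut) (v : List Bool) : (g.toPerm v).length = v.length :=
  g.2.1 v

theorem toPerm_prefix_iff (g : TreeAut) (u v : List Bool) :
    g.toPerm u <+: g.toPerm v ↔ u <+: v :=
  g.2.2 u v

/-- The fixator of the `m`-th level of the tree. -/
def levelStab (m : ℕ) : Subgroup TreeAut where
  carrier := {g | ∀ v : List Bool, v.length = m → g.toPerm v = v}
  one_mem' := fun v _ => by rw [map_one, Equiv.Perm.one_apply]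
  mul_mem' := by
    intro g h hg hh v hv
    rw [map_mul, Equiv.Perm.mul_apply, hh v hv, hg v hv]
  inv_mem' := by
    intro g hg v hv
    rw [map_inv, Equiv.Perm.inv_eq_iff_eq, hg v hv]

theorem mem_levelStab {m : ℕ} {g : TreeAut} :
    g ∈ levelStab m ↔ ∀ v : List Bool, v.length = m → g.toPerm v = v := Iff.rfl

theorem levelStab_zero (g : TreeAut) : g ∈ levelStab 0 := by
  intro v hv
  have h := length_toPerm g v
  rw [hv] at h
  rw [List.length_eq_zero_iff.mp hv] at h ⊢
  exact List.length_eq_zero_iff.mp h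

theorem levelStab_anti {m n : ℕ} (h : m ≤ n) : levelStab n ≤ levelStab m := by
  intro g hg v hv
  have hw : (v ++ List.replicate (n - m) false).length = n := by
    rw [List.length_append, List.length_replicate, hv]; omega
  have h1 : g.toPerm v <+: g.toPerm (v ++ List.replicate (n - m) false) :=
    (toPerm_prefix_iff g _ _).2 (List.prefix_append _ _)
  rw [hg _ hw] at h1
  exact (List.prefix_of_prefix_length_le h1 (List.prefix_append _ _)
    (length_toPerm g v).le).eq_of_length (length_toPerm g v)

theorem eq_one_of_forall_mem_levelStab {g : TreeAut} (h : ∀ m, g ∈ levelStab m) : g = 1 :=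
  toPerm_injective (Equiv.ext fun v => by rw [map_one]; exact h v.length v rfl)

/-! ### The standard metric on the profinite group of tree automorphisms -/

/-- `1 / |Aut T mod m|`, where `|Aut T mod m| = 2 ^ (2 ^ m - 1)`. -/
noncomputable def radius (m : ℕ) : ℝ := ((2 : ℝ) ^ (2 ^ m - 1))⁻¹

theorem radius_pos (m : ℕ) : 0 < radius m := by unfold radius; positivity

theorem radius_strictAnti : StrictAnti radius := by
  refine strictAnti_nat_of_succ_lt fun m => ?_
  unfold radius
  have h1 : 2 ^ m - 1 < 2 ^ (m + 1) - 1 := by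
    have := Nat.one_le_two_pow (n := m)
    rw [pow_succ]; omega
  exact inv_strictAnti₀ (by positivity) (pow_lt_pow_right₀ one_lt_two h1)

/-- The distance between `g` and `h` is the infimum of `1 / |Aut T mod m|` over all `m` such that
`g` and `h` agree on the first `m` levels. -/
noncomputable def treeDist (g h : TreeAut) : ℝ :=
  sInf (radius '' {m : ℕ | g⁻¹ * h ∈ levelStab m})

theorem treeDist_bddBelow (g h : TreeAut) :
    BddBelow (radius '' {m : ℕ | g⁻¹ * h ∈ levelStab m}) :=
  ⟨0, by rintro _ ⟨m, _, rfl⟩; exact (radius_pos m).le⟩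

theorem treeDist_nonempty (g h : TreeAut) :
    (radius '' {m : ℕ | g⁻¹ * h ∈ levelStab m}).Nonempty :=
  ⟨radius 0, 0, levelStab_zero _, rfl⟩

theorem treeDist_le {g h : TreeAut} {m : ℕ} (hm : g⁻¹ * h ∈ levelStab m) :
    treeDist g h ≤ radius m :=
  csInf_le (treeDist_bddBelow g h) ⟨m, hm, rfl⟩

theorem exists_of_treeDist_lt {g h : TreeAut} {r : ℝ} (hr : treeDist g h < r) :
    ∃ m, g⁻¹ * h ∈ levelStab m ∧ radius m < r := by
  obtain ⟨_, ⟨m, hm, rfl⟩, hlt⟩ := exists_lt_of_csInf_lt (treeDist_nonempty g h) hr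
  exact ⟨m, hm, hlt⟩

theorem treeDist_nonneg (g h : TreeAut) : 0 ≤ treeDist g h :=
  le_csInf (treeDist_nonempty g h) (by rintro _ ⟨m, _, rfl⟩; exact (radius_pos m).le)

theorem mem_levelStab_of_treeDist_lt {g h : TreeAut} {m : ℕ} (hr : treeDist g h < radius m) :
    g⁻¹ * h ∈ levelStab m := by
  obtain ⟨l, hl, hlt⟩ := exists_of_treeDist_lt hr
  exact levelStab_anti (radius_strictAnti.lt_iff_gt.mp hlt).le hl

theorem treeDist_self (g : TreeAut) : treeDist g g = 0 := by
  refine le_antisymm (le_of_forall_pos_le_add fun ε hε => ?_) (treeDist_nonneg g g)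
  obtain ⟨m, hm⟩ := exists_pow_lt_of_lt_one hε (by norm_num : (1 / 2 : ℝ) < 1)
  have h1 : treeDist g g ≤ radius m := treeDist_le (by rw [inv_mul_cancel]; exact one_mem _)
  have h2 : radius m ≤ (1 / 2 : ℝ) ^ m := by
    unfold radius
    rw [one_div, inv_pow]
    have : m ≤ 2 ^ m - 1 := Nat.le_sub_one_of_lt Nat.lt_two_pow_self
    exact inv_anti₀ (by positivity) (pow_le_pow_right₀ one_le_two this)
  linarith

theorem treeDist_comm (g h : TreeAut) : treeDist g h = treeDist h g := by
  unfold treeDist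
  congr 2
  ext m
  show g⁻¹ * h ∈ levelStab m ↔ h⁻¹ * g ∈ levelStab m
  rw [← inv_mem_iff, mul_inv_rev, inv_inv]

theorem treeDist_le_max (f g h : TreeAut) :
    treeDist f h ≤ max (treeDist f g) (treeDist g h) := by
  by_contra! hlt
  obtain ⟨m, hm, hm'⟩ := exists_of_treeDist_lt ((le_max_left _ _).trans_lt hlt)
  obtain ⟨l, hl, hl'⟩ := exists_of_treeDist_lt ((le_max_right _ _).trans_lt hlt)
  have key : ∀ j, f⁻¹ * g ∈ levelStab j → g⁻¹ * h ∈ levelStab j → treeDist f h ≤ radius j := by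
    intro j h1 h2
    refine treeDist_le ?_
    have := mul_mem h1 h2
    rwa [mul_assoc, mul_inv_cancel_left] at this
  rcases le_total m l with hml | hml
  · exact absurd hm' (key m hm (levelStab_anti hml hl)).not_gt
  · exact absurd hl' (key l (levelStab_anti hml hm) hl).not_gt

noncomputable instance : MetricSpace TreeAut where
  dist := treeDist
  dist_self := treeDist_self
  dist_comm := treeDist_comm
  dist_triangle f g h := (treeDist_le_max f g h).trans
    (max_le_add_of_nonneg (treeDist_nonneg f g) (treeDist_nonneg g h))
  eq_of_dist_eq_zero := by
    intro g h h0
    have : g⁻¹ * h = 1 := eq_one_of_forall_mem_levelStab fun m =>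
      mem_levelStab_of_treeDist_lt (lt_of_eq_of_lt h0 (radius_pos m))
    exact (inv_mul_eq_one.mp this)

/-- The order of `G mod m = G / Stab_G(m)`, the group of actions of `G` on the first `m` levels. -/
noncomputable def cardMod (G : Subgroup TreeAut) (m : ℕ) : ℕ :=
  Nat.card (G ⧸ (levelStab m).subgroupOf G)

/-- The Hausdorff dimension of (the closure of) a subgroup of the automorphism group of the tree,
with respect to the standard metric. -/
noncomputable def hausdorffDim (G : Subgroup TreeAut) : ENNReal :=
  dimH (closure (G : Set TreeAut))

end TreeAut

/-! ### Spinal groups -/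

/-- The action of `C_2 = ZMod 2` on the vertices by exchanging the two maximal subtrees. -/
def swapFun (c : ZMod 2) : List Bool → List Bool
  | [] => []
  | x :: v => (if c = 0 then x else !x) :: v

/-- For a sequence `c` in `C_2`, the map `⟨c 0, ⟨c 1, ⟨c 2, …⟩⟩⟩`: it fixes the vertices `1 ^ k`
and acts as `c k` on the subtree below the vertex `1 ^ k 0`. -/
def spineFun : (ℕ → ZMod 2) → List Bool → List Bool
  | _, [] => []
  | c, false :: v => false :: swapFun (c 0) v
  | c, true :: v => true :: spineFun (fun j => c (j + 1)) v

theorem swapFun_involutive (c : ZMod 2) : Function.Involutive (swapFun c) := by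
  intro v
  cases v with
  | nil => rfl
  | cons x v => by_cases h : c = 0 <;> simp [swapFun, h]

theorem length_swapFun (c : ZMod 2) (v : List Bool) : (swapFun c v).length = v.length := by
  cases v <;> simp [swapFun]

theorem swapFun_prefix (c : ZMod 2) {u v : List Bool} (h : u <+: v) :
    swapFun c u <+: swapFun c v := by
  cases u with
  | nil => simp [swapFun]
  | cons x u =>
    cases v with
    | nil => simp at h
    | cons y v =>
      rw [List.cons_prefix_cons] at h
      obtain ⟨rfl, h⟩ := h
      simpa [swapFun, List.cons_prefix_cons] using h

theorem spineFun_involutive (c : ℕ → ZMod 2) : Function.Involutive (spineFun c) := by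
  intro v
  induction v generalizing c with
  | nil => rfl
  | cons x v ih =>
    cases x
    · simp only [spineFun, swapFun_involutive (c 0) v]
    · simp only [spineFun, ih]

theorem length_spineFun (c : ℕ → ZMod 2) (v : List Bool) :
    (spineFun c v).length = v.length := by
  induction v generalizing c with
  | nil => rfl
  | cons x v ih => cases x <;> simp [spineFun, length_swapFun, ih]

theorem spineFun_prefix (c : ℕ → ZMod 2) {u v : List Bool} (h : u <+: v) :
    spineFun c u <+: spineFun c v := by
  induction u generalizing c v with
  | nil => simp [spineFun]
  | cons x u ih =>
    cases v with
    | nil => simp at h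
    | cons y v =>
      rw [List.cons_prefix_cons] at h
      obtain ⟨rfl, h⟩ := h
      cases x
      · simpa [spineFun, List.cons_prefix_cons] using swapFun_prefix (c 0) h
      · simpa [spineFun, List.cons_prefix_cons] using ih _ h

/-- The tree automorphism given by an involution that preserves levels and the ancestor relation. -/
def TreeAut.ofInvolutive (f : List Bool → List Bool) (hf : Function.Involutive f)
    (hl : ∀ v, (f v).length = v.length) (hp : ∀ u v, u <+: v → f u <+: f v) : TreeAut :=
  ⟨hf.toPerm f, hl, fun u v => ⟨fun h => by
    have := hp _ _ h
    rwa [Function.Involutive.coe_toPerm, hf u, hf v] at this, hp u v⟩⟩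

/-- The generator `a`, which exchanges the two maximal subtrees. -/
def rootSwap : TreeAut :=
  TreeAut.ofInvolutive (swapFun 1) (swapFun_involutive 1) (length_swapFun 1)
    fun _ _ h => swapFun_prefix 1 h

/-- The action of `b` in the level group `B = C_2 ^ d`: `b = ⟨ω₁(b), ⟨ω₂(b), ⟨ω₃(b), …⟩⟩⟩`.
Sequences are indexed from `0`, so that `ω j` is the letter `ω_{j+1}`. -/
def spineElt {d : ℕ} (ω : ℕ → Module.Dual (ZMod 2) (Fin d → ZMod 2)) (b : Fin d → ZMod 2) :
    TreeAut :=
  TreeAut.ofInvolutive (spineFun fun j => ω j b) (spineFun_involutive _) (length_spineFun _)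
    fun _ _ h => spineFun_prefix _ h

/-- The spinal group `G_ω`, generated by `A = ⟨a⟩` and `B`. -/
def spinalGroup {d : ℕ} (ω : ℕ → Module.Dual (ZMod 2) (Fin d → ZMod 2)) : Subgroup TreeAut :=
  Subgroup.closure ({rootSwap} ∪ Set.range (spineElt ω))

/-! ### Syllables and dimensions -/

/-- `s_k = a_1 + ⋯ + a_k`. The sequence of syllable lengths is indexed from `1`. -/
def syllSum (a : ℕ → ℕ) (k : ℕ) : ℕ := ∑ j ∈ Finset.Icc 1 k, a j

/-- `ω = w_1^{a_1} w_2^{a_2} ⋯` in syllable form; the values `w 0` and `a 0` play no role. -/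
structure IsSyllableForm {E : Type*} (ω : ℕ → E) (w : ℕ → E) (a : ℕ → ℕ) : Prop where
  pos : ∀ i, 1 ≤ i → 1 ≤ a i
  ne_succ : ∀ i, 1 ≤ i → w i ≠ w (i + 1)
  letter : ∀ k j, j < a (k + 1) → ω (syllSum a k + j) = w (k + 1)

/-- `σ^n ω`. -/
def seqShift {E : Type*} (n : ℕ) (ω : ℕ → E) : ℕ → E := fun j => ω (j + n)

/-- `dim(ω mod m)`: the dimension of the span of the first `m - 1` letters of `ω`, that is, of the
letters of the syllables that meet the prefix of length `m - 1`. -/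
noncomputable def dimMod {d : ℕ} (ω : ℕ → Module.Dual (ZMod 2) (Fin d → ZMod 2)) (m : ℕ) : ℕ :=
  Module.finrank (ZMod 2) (Submodule.span (ZMod 2) (ω '' {j : ℕ | j + 1 < m}))

/-- `diminf(ω) = liminf_n lim_m dim(σ^n ω mod m)`; the inner sequence is nondecreasing in `m` and
bounded by `d`, so its limit is its supremum. -/
noncomputable def diminf {d : ℕ} (ω : ℕ → Module.Dual (ZMod 2) (Fin d → ZMod 2)) : ℕ :=
  liminf (fun n : ℕ => ⨆ m : ℕ, dimMod (seqShift n ω) m) atTop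

/-- `Σ_k = ∑_{j=1}^k 2^{s_{j-1}} a_j`. -/
def bigSigma (a : ℕ → ℕ) (k : ℕ) : ℕ := ∑ j ∈ Finset.Icc 1 k, 2 ^ syllSum a (j - 1) * a j

/-- `λ_i(k)`: the smallest `l` with `dim(σ^{s_l} ω mod (s_k + 1 - s_l)) = i`, that is, such that
the syllables number `l + 1, …, k` of `ω` span a space of dimension `i`. For `l ≥ k` no syllable is
left and the dimension is `0`. -/
noncomputable def lam {d : ℕ} (ω : ℕ → Module.Dual (ZMod 2) (Fin d → ZMod 2)) (a : ℕ → ℕ)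
    (i k : ℕ) : ℕ :=
  sInf {l : ℕ | dimMod (seqShift (syllSum a l) ω) (syllSum a k + 1 - syllSum a l) = i}

/-- The expression whose lower limit over `k` gives twice the Hausdorff dimension. -/
noncomputable def dimExpr {d : ℕ} (ω : ℕ → Module.Dual (ZMod 2) (Fin d → ZMod 2)) (a : ℕ → ℕ)
    (n k : ℕ) : ℝ :=
  (bigSigma a k : ℝ) / 2 ^ syllSum a k
    + 1 / 2 ^ syllSum a k * ∑ i ∈ Finset.Icc 2 (n - 1),
        (2 : ℝ) ^ syllSum a (lam ω a i k) * (2 - 1 / 2 ^ a (lam ω a i k))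
    + 1 / 2 ^ a k * (1 - 1 / 2 ^ a (k - 1))

/-! For this metric the closure of a subgroup has Hausdorff dimension equal to its lower box
dimension, so `hausdorffDim_eq` reduces the theorem to the orders of `G_ω mod m`. Covering by the
cosets of one level bounds the dimension from above. From below, compactness makes a cover finite,
and B. H. Neumann's lemma says that finitely many cosets cover a group only if the reciprocals of
their indices sum to at least 1.

For the orders, let `Q = G_ω mod (m + 1)`, `Q' = G_{σω} mod m` and `χ = ω₁`. Sections embed `Q` into
`Q' ≀ C_2`, and `|Q|` is twice the order of the subgroup of `Q' × Q'` generated by all `(χ(b), b)`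
and `(b, χ(b))`. If `χ` lies outside the span of the remaining visible letters, some `c` with `χ(c)
= 1` acts trivially in `Q'`, the subgroup is everything, and `|Q| = 2|Q'|²`. Otherwise it projects
onto each factor with kernel `K'`, the normal closure of `ker χ` in `Q'`, and `|Q| = 2|Q'||K'|`. For
any non-zero `χ`, the normal closure `K` of `ker χ` in `Q` has index 2 if `χ` is not in the span of
the visible letters, and 8 if it is in the span but is not the first letter; if it is the visible
first letter, then `K ≅ K' × K'` and the index follows recursively (`card_and_index`).

Solved along syllables (`IsSyllableForm.cardExp_eq`), the recursion gives each complete syllable `j`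
before the last the contribution `2^{s_{j-1}} a_j`, plus `2^{s_j}(2 - 2^{-a_j})` when its letter is
outside the span of the later visible ones. Those `j` are where the dimension of the span of
syllables `j + 1, …, k` drops: apart from boundedly many early ones they are the `λ_i` and `k - 1`,
the latter combining with a defect of the last syllable into the last term of the formula. From the
second syllable on, `log₂|G_ω mod m| / 2^m` does not increase within a syllable, so its lower limit
is attained along the ends `m = s_k + 1`. -/

/-! ### Wreath products with the group of order two -/

/-- The wreath product `Q ≀ C_2`, acting on two copies of a set on which `Q` acts: `left x` is the
section at `x`, and `flip` tells whether the two copies are exchanged. -/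
@[ext]
structure Wr (Q : Type*) where
  left : Bool → Q
  flip : Bool

namespace Wr

variable {Q R : Type*} [Group Q] [Group R]

-- The right factor acts first, so the section of `g` is taken at the image of `x` under `h`.
instance : Mul (Wr Q) := ⟨fun g h => ⟨fun x => g.left (xor x h.flip) * h.left x, xor g.flip h.flip⟩⟩

instance : One (Wr Q) := ⟨⟨1, false⟩⟩

instance : Inv (Wr Q) := ⟨fun g => ⟨fun x => (g.left (xor x g.flip))⁻¹, g.flip⟩⟩

@[simp] theorem mul_left (g h : Wr Q) (x : Bool) :
    (g * h).left x = g.left (xor x h.flip) * h.left x := rfl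

@[simp] theorem mul_flip (g h : Wr Q) : (g * h).flip = xor g.flip h.flip := rfl

@[simp] theorem one_left (x : Bool) : (1 : Wr Q).left x = 1 := rfl

@[simp] theorem one_flip : (1 : Wr Q).flip = false := rfl

@[simp] theorem inv_left (g : Wr Q) (x : Bool) : g⁻¹.left x = (g.left (xor x g.flip))⁻¹ := rfl

@[simp] theorem inv_flip (g : Wr Q) : g⁻¹.flip = g.flip := rfl

instance : Group (Wr Q) where
  mul_assoc f g h := by
    ext x
    · simp only [mul_left, mul_flip, mul_assoc]
      congr 2
      cases x <;> cases g.flip <;> cases h.flip <;> rfl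
    · simp
  one_mul g := by ext x <;> simp
  mul_one g := by ext x <;> simp
  inv_mul_cancel g := by
    ext x
    · simp
    · simp

instance [Finite Q] : Finite (Wr Q) :=
  Finite.of_injective (fun g : Wr Q => (g.left, g.flip)) fun g h e => by
    simp only [Prod.mk.injEq] at e
    exact Wr.ext e.1 e.2

/-- Functoriality of the wreath product. -/
def map (f : Q →* R) : Wr Q →* Wr R where
  toFun g := ⟨fun x => f (g.left x), g.flip⟩
  map_one' := by ext x <;> simp
  map_mul' g h := by ext x <;> simp

@[simp] theorem map_left (f : Q →* R) (g : Wr Q) (x : Bool) : (map f g).left x = f (g.left x) := rfl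

@[simp] theorem map_flip (f : Q →* R) (g : Wr Q) : (map f g).flip = g.flip := rfl

/-- The action on the two copies. -/
def flipHom : Wr Q →* Multiplicative (ZMod 2) where
  toFun g := .ofAdd (if g.flip then 1 else 0)
  map_one' := rfl
  map_mul' g h := by
    rw [← ofAdd_add, mul_flip]
    cases g.flip <;> cases h.flip <;> rfl

/-- The product of the values of a homomorphism to an abelian group on the two sections. -/
def prodHom {A : Type*} [CommGroup A] (f : Q →* A) : Wr Q →* A where
  toFun g := f (g.left false) * f (g.left true)
  map_one' := by simp
  map_mul' g h := by
    simp only [mul_left, map_mul]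
    cases h.flip
    · simp only [Bool.xor_false]; exact mul_mul_mul_comm _ _ _ _
    · simp only [Bool.xor_true, Bool.not_false, Bool.not_true]
      rw [mul_mul_mul_comm, mul_comm (f (g.left true))]

/-- The homomorphism to `A ≀ C_2`, for abelian `A`, that mixes both sections. -/
def mixHom {A : Type*} [CommGroup A] (f f' : Q →* A) : Wr Q →* Wr A where
  toFun g := ⟨fun x => f (g.left x) * f' (g.left !x), g.flip⟩
  map_one' := by ext x <;> simp
  map_mul' g h := by
    ext x
    · simp only [mul_left, map_mul, Bool.not_xor]
      rw [mul_mul_mul_comm]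
    · simp

end Wr

/-! ### Groups generated by two involutions -/

/-- Two involutions generate a dihedral group: the rotations are the powers of `x * y`, and
multiplying by `x` gives the reflections. -/
theorem eq_of_mem_closure_involutions {Q : Type*} [Group Q] {x y z : Q} (hx : x * x = 1)
    (hy : y * y = 1) (hz : z ∈ Subgroup.closure {x, y}) :
    ∃ i : ℤ, z = (x * y) ^ i ∨ z = (x * y) ^ i * x := by
  have hxi : x⁻¹ = x := inv_eq_of_mul_eq_one_left hx
  have hyi : y⁻¹ = y := inv_eq_of_mul_eq_one_left hy
  have key : ∀ z, (∃ i : ℤ, z = (x * y) ^ i ∨ z = (x * y) ^ i * x) →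
      (∃ i : ℤ, z * x = (x * y) ^ i ∨ z * x = (x * y) ^ i * x) ∧
      (∃ i : ℤ, z * y = (x * y) ^ i ∨ z * y = (x * y) ^ i * x) := by
    rintro _ ⟨i, rfl | rfl⟩
    · refine ⟨⟨i, Or.inr rfl⟩, ⟨i - 1, Or.inr ?_⟩⟩
      rw [zpow_sub_one, mul_inv_rev, hxi, hyi, mul_assoc, mul_assoc, hx, mul_one]
    · refine ⟨⟨i, Or.inl (by rw [mul_assoc, hx, mul_one])⟩, ⟨i + 1, Or.inl ?_⟩⟩
      rw [zpow_add_one, mul_assoc]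
  induction hz using Subgroup.closure_induction_right with
  | one => exact ⟨0, Or.inl (by simp)⟩
  | mul_right z _ u hu ih =>
    rcases hu with rfl | hu
    · exact (key _ ih).1
    · rw [Set.mem_singleton_iff.mp hu]; exact (key _ ih).2
  | mul_inv_cancel z _ u hu ih =>
    rcases hu with rfl | hu
    · rw [hxi]; exact (key _ ih).1
    · rw [Set.mem_singleton_iff.mp hu, hyi]; exact (key _ ih).2

/-! ### The subgroup of pairs of sections -/

section Cross

open Multiplicative

theorem eq_top_of_range_sup_eq_top {Q V : Type*} [Group Q] [AddCommGroup V]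
    {α : Multiplicative (ZMod 2) →* Q} {β : Multiplicative V →* Q}
    (hgen : α.range ⊔ β.range = ⊤) (P : Subgroup Q)
    (hα : α (ofAdd 1) ∈ P) (hβ : ∀ b, β (ofAdd b) ∈ P) : P = ⊤ := by
  rw [eq_top_iff, ← hgen, sup_le_iff]
  constructor
  · rintro _ ⟨c, rfl⟩
    have : ∀ z : ZMod 2, z = 0 ∨ z = 1 := by decide
    rcases this c.toAdd with h | h
    · rw [show c = 1 from h, map_one]; exact one_mem _
    · rw [show c = ofAdd 1 from h]; exact hα
  · rintro _ ⟨b, rfl⟩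
    exact hβ b.toAdd

variable {Q V : Type*} [Group Q] [AddCommGroup V] [Module (ZMod 2) V]
  (α : Multiplicative (ZMod 2) →* Q) (β : Multiplicative V →* Q) (χ : Module.Dual (ZMod 2) V)

/-- The subgroup of `Q × Q` generated by the pairs `(χ(b), b)` and `(b, χ(b))`. -/
def crossSub : Subgroup (Q × Q) :=
  Subgroup.closure ({x | ∃ b : V, x = (α (ofAdd (χ b)), β (ofAdd b))} ∪
    {x | ∃ b : V, x = (β (ofAdd b), α (ofAdd (χ b)))})

/-- The normal closure of the image of `ker χ`. -/
def kerClosure : Subgroup Q := Subgroup.normalClosure {x | ∃ b : V, χ b = 0 ∧ x = β (ofAdd b)}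

instance : (kerClosure β χ).Normal := Subgroup.normalClosure_normal

variable {α β χ}

theorem mem_crossSub_left (b : V) : (α (ofAdd (χ b)), β (ofAdd b)) ∈ crossSub α β χ :=
  Subgroup.subset_closure (Or.inl ⟨b, rfl⟩)

theorem mem_crossSub_right (b : V) : (β (ofAdd b), α (ofAdd (χ b))) ∈ crossSub α β χ :=
  Subgroup.subset_closure (Or.inr ⟨b, rfl⟩)

theorem mem_kerClosure {b : V} (hb : χ b = 0) : β (ofAdd b) ∈ kerClosure β χ :=
  Subgroup.subset_normalClosure ⟨b, hb, rfl⟩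

theorem swap_mem_crossSub {x : Q × Q} (hx : x ∈ crossSub α β χ) : x.swap ∈ crossSub α β χ := by
  induction hx using Subgroup.closure_induction with
  | mem x hx =>
    rcases hx with ⟨b, rfl⟩ | ⟨b, rfl⟩
    · exact mem_crossSub_right b
    · exact mem_crossSub_left b
  | one => exact one_mem _
  | mul x y _ _ hx hy => exact mul_mem hx hy
  | inv x _ hx => exact inv_mem hx

theorem exists_eq_one_of_ne_zero (hχ : χ ≠ 0) : ∃ c, χ c = 1 := by
  obtain ⟨c, hc⟩ := DFunLike.ne_iff.mp hχ
  refine ⟨c, ?_⟩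
  have : ∀ z : ZMod 2, z ≠ 0 → z = 1 := by decide
  exact this _ hc

theorem exists_mem_crossSub (hgen : α.range ⊔ β.range = ⊤) (hχ : χ ≠ 0) (g : Q) :
    ∃ h, (g, h) ∈ crossSub α β χ := by
  have : (crossSub α β χ).map (MonoidHom.fst Q Q) = ⊤ := by
    apply eq_top_of_range_sup_eq_top hgen
    · obtain ⟨c, hc⟩ := exists_eq_one_of_ne_zero hχ
      exact ⟨_, mem_crossSub_left c, by simp [hc]⟩
    · exact fun b => ⟨_, mem_crossSub_right b, rfl⟩
  have hg : g ∈ (crossSub α β χ).map (MonoidHom.fst Q Q) := this ▸ Subgroup.mem_top g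
  obtain ⟨⟨g', h⟩, hm, rfl⟩ := hg
  exact ⟨h, hm⟩

/-- Since the subgroup projects onto the first factor, conjugation of `(k, 1)` by any `g` can be
realised inside it. -/
theorem comap_inl_normal (hgen : α.range ⊔ β.range = ⊤) (hχ : χ ≠ 0) :
    ((crossSub α β χ).comap (MonoidHom.inl Q Q)).Normal := by
  refine ⟨fun k hk g => ?_⟩
  obtain ⟨h, hh⟩ := exists_mem_crossSub hgen hχ g
  have := mul_mem (mul_mem hh (Subgroup.mem_comap.mp hk)) (inv_mem hh)
  simpa [Subgroup.mem_comap] using this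

theorem kerClosure_le_comap_inl (hgen : α.range ⊔ β.range = ⊤) (hχ : χ ≠ 0) :
    kerClosure β χ ≤ (crossSub α β χ).comap (MonoidHom.inl Q Q) := by
  have := comap_inl_normal (α := α) (β := β) hgen hχ
  apply Subgroup.normalClosure_le_normal
  rintro _ ⟨b, hb, rfl⟩
  have := mem_crossSub_right (α := α) (β := β) (χ := χ) b
  rw [hb, ofAdd_zero, map_one] at this
  exact this

/-- An element `c` that is trivial in `Q` but has `χ c = 1` produces `(a, 1)`. This splits the two
coordinates of every generator. -/
theorem crossSub_eq_top (hgen : α.range ⊔ β.range = ⊤) {c : V} (hc : χ c = 1)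
    (hβc : β (ofAdd c) = 1) : crossSub α β χ = ⊤ := by
  have h1 : (α (ofAdd 1), (1 : Q)) ∈ crossSub α β χ := by
    have := mem_crossSub_left (α := α) (β := β) (χ := χ) c
    rwa [hc, hβc] at this
  have h2 : ∀ z : ZMod 2, ((1 : Q), α (ofAdd z)) ∈ crossSub α β χ := by
    intro z
    have : z = 0 ∨ z = 1 := by revert z; decide
    rcases this with rfl | rfl
    · rw [ofAdd_zero, map_one]; exact one_mem _
    · exact swap_mem_crossSub h1
  have h3 : (crossSub α β χ).comap (MonoidHom.inl Q Q) = ⊤ := by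
    apply eq_top_of_range_sup_eq_top hgen
    · exact h1
    · intro b
      have := mul_mem (mem_crossSub_right (α := α) (β := β) (χ := χ) b) (inv_mem (h2 (χ b)))
      simpa [Subgroup.mem_comap] using this
  have h4 : ∀ g : Q, (g, (1 : Q)) ∈ crossSub α β χ := fun g => by
    have : g ∈ (crossSub α β χ).comap (MonoidHom.inl Q Q) := h3 ▸ Subgroup.mem_top g
    exact this
  rw [eq_top_iff]
  rintro ⟨g, h⟩ -
  have := mul_mem (h4 g) (swap_mem_crossSub (h4 h))
  simpa using this

theorem mk_kerClosure_of_eq_zero {b : V} (hb : χ b = 0) :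
    QuotientGroup.mk' (kerClosure β χ) (β (ofAdd b)) = 1 :=
  (QuotientGroup.eq_one_iff _).mpr (mem_kerClosure hb)

theorem mk_kerClosure_of_eq_one {b c : V} (hb : χ b = 1) (hc : χ c = 1) :
    QuotientGroup.mk' (kerClosure β χ) (β (ofAdd b)) =
      QuotientGroup.mk' (kerClosure β χ) (β (ofAdd c)) := by
  have : b = (b - c) + c := by abel
  rw [this, ofAdd_add, map_mul, map_mul,
    mk_kerClosure_of_eq_zero (by rw [map_sub, hb, hc, sub_self]), one_mul]

theorem mem_closure_quotient_kerClosure (hgen : α.range ⊔ β.range = ⊤) {c : V} (hc : χ c = 1)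
    (z : Q ⧸ kerClosure β χ) :
    z ∈ Subgroup.closure {QuotientGroup.mk' (kerClosure β χ) (α (ofAdd 1)),
      QuotientGroup.mk' (kerClosure β χ) (β (ofAdd c))} := by
  set P := Subgroup.closure {QuotientGroup.mk' (kerClosure β χ) (α (ofAdd 1)),
      QuotientGroup.mk' (kerClosure β χ) (β (ofAdd c))}
  have h := eq_top_of_range_sup_eq_top hgen (P.comap (QuotientGroup.mk' (kerClosure β χ)))
    (Subgroup.subset_closure (Or.inl rfl)) (fun b => ?_)
  · obtain ⟨g, rfl⟩ := QuotientGroup.mk_surjective z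
    have : g ∈ P.comap (QuotientGroup.mk' (kerClosure β χ)) := h ▸ Subgroup.mem_top g
    exact this
  · have h01 : χ b = 0 ∨ χ b = 1 := by generalize χ b = z; revert z; decide
    rw [Subgroup.mem_comap]
    rcases h01 with hb | hb
    · rw [mk_kerClosure_of_eq_zero hb]; exact one_mem _
    · rw [mk_kerClosure_of_eq_one hb hc]
      exact Subgroup.subset_closure (Or.inr rfl)

theorem map_ofAdd_mul_self (f : Multiplicative V →* Q) (b : V) :
    f (ofAdd b) * f (ofAdd b) = 1 := by
  rw [← map_mul, ← ofAdd_add, ← two_smul (ZMod 2) b]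
  have : (2 : ZMod 2) = 0 := rfl
  rw [this, zero_smul, ofAdd_zero, map_one]

theorem le_ker_of_kerClosure {R : Type*} [Group R] (f : Q →* R)
    (hf : ∀ b, χ b = 0 → f (β (ofAdd b)) = 1) : kerClosure β χ ≤ f.ker := by
  apply Subgroup.normalClosure_le_normal
  rintro _ ⟨b, hb, rfl⟩
  exact hf b hb

/-- Modulo the normal closure `K` of `ker χ`, the group is generated by two involutions `A`, `C`,
and the pairs lie in the dihedral group generated by `(A, C)` and `(C, A)`. There a trivial second
coordinate forces a trivial first one. -/
theorem mem_kerClosure_of_mem_crossSub (hχ : χ ≠ 0)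
    (p q : Q →* Multiplicative (ZMod 2)) (hpα : ∀ z, p (α z) = z) (hpβ : ∀ b, p (β b) = 1)
    (hqα : ∀ z, q (α z) = 1) (hqβ : ∀ b, q (β (ofAdd b)) = ofAdd (χ b)) {g : Q}
    (hg : (g, 1) ∈ crossSub α β χ) : g ∈ kerClosure β χ := by
  obtain ⟨c, hc⟩ := exists_eq_one_of_ne_zero hχ
  set K := kerClosure β χ
  set A : Q ⧸ K := ((α (ofAdd 1) : Q) : Q ⧸ K) with hA
  set C : Q ⧸ K := ((β (ofAdd c) : Q) : Q ⧸ K) with hC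
  have hA2 : A * A = 1 := by
    rw [hA, ← QuotientGroup.mk_mul, map_ofAdd_mul_self, QuotientGroup.mk_one]
  have hC2 : C * C = 1 := by
    rw [hC, ← QuotientGroup.mk_mul, map_ofAdd_mul_self, QuotientGroup.mk_one]
  have hαz : ∀ z : ZMod 2, z = 0 ∨ z = 1 := by decide
  have hb0 : ∀ b, χ b = 0 → ((β (ofAdd b) : Q) : Q ⧸ K) = 1 := fun b hb =>
    mk_kerClosure_of_eq_zero hb
  have hb1 : ∀ b, χ b = 1 → ((β (ofAdd b) : Q) : Q ⧸ K) = C := fun b hb =>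
    mk_kerClosure_of_eq_one hb hc
  have hH : ∀ x ∈ crossSub α β χ, ((x.1 : Q ⧸ K), (x.2 : Q ⧸ K)) ∈
      Subgroup.closure {((A, C) : (Q ⧸ K) × (Q ⧸ K)), (C, A)} := by
    intro x hx
    induction hx using Subgroup.closure_induction with
    | mem x hx =>
      rcases hx with ⟨b, rfl⟩ | ⟨b, rfl⟩
      · rcases hαz (χ b) with h | h
        · simp only [h, hb0 b h, ofAdd_zero, map_one, QuotientGroup.mk_one]; exact one_mem _
        · simp only [h, hb1 b h]; exact Subgroup.subset_closure (Or.inl rfl)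
      · rcases hαz (χ b) with h | h
        · simp only [h, hb0 b h, ofAdd_zero, map_one, QuotientGroup.mk_one]; exact one_mem _
        · simp only [h, hb1 b h]; exact Subgroup.subset_closure (Or.inr rfl)
    | one => exact one_mem _
    | mul x y _ _ hx hy => exact mul_mem hx hy
    | inv x _ hx => exact inv_mem hx
  obtain ⟨i, h | h⟩ := eq_of_mem_closure_involutions (by simp [hA2, hC2]) (by simp [hA2, hC2])
    (hH _ hg)
  · simp only [Prod.mk_mul_mk, Prod.ext_iff, Prod.pow_fst, Prod.pow_snd, QuotientGroup.mk_one] at h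
    rw [← QuotientGroup.eq_one_iff, h.1]
    -- The second coordinate gives `(C * A) ^ i = 1`, and `A * C` is a conjugate of `C * A`.
    have hCA : A * C = A * (C * A) * A⁻¹ := by group
    rw [hCA, conj_zpow, ← h.2, mul_one, mul_inv_cancel]
  · exfalso
    simp only [Prod.mk_mul_mk, Prod.ext_iff, Prod.pow_fst, Prod.pow_snd, QuotientGroup.mk_one,
      Prod.fst_mul, Prod.snd_mul] at h
    -- A reflection is a word of odd length. The product `p * q` sends both `A` and `C` to the
    -- generator, hence counts length modulo 2 and excludes a trivial second coordinate.
    let f : Q ⧸ K →* Multiplicative (ZMod 2) := QuotientGroup.lift K (p * q)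
      (le_ker_of_kerClosure (p * q) fun b hb => by
        rw [MonoidHom.mul_apply, hpβ, hqβ, hb]; rfl)
    have hfA : f A = ofAdd 1 := by
      show (p * q) (α (ofAdd 1)) = _
      rw [MonoidHom.mul_apply, hpα, hqα, mul_one]
    have hfC : f C = ofAdd 1 := by
      show (p * q) (β (ofAdd c)) = _
      rw [MonoidHom.mul_apply, hpβ, hqβ, hc, one_mul]
    have := congrArg f h.2
    rw [map_one, map_mul, map_zpow, map_mul, hfA, hfC] at this
    have h11 : (ofAdd (1 : ZMod 2)) * ofAdd 1 = 1 := rfl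
    rw [h11, one_zpow, one_mul] at this
    exact absurd this (by decide)

/-- The second projection is onto, and its kernel is the normal closure of `ker χ` in the first
factor. -/
theorem card_crossSub [Finite Q] (hgen : α.range ⊔ β.range = ⊤) (hχ : χ ≠ 0)
    (p q : Q →* Multiplicative (ZMod 2)) (hpα : ∀ z, p (α z) = z) (hpβ : ∀ b, p (β b) = 1)
    (hqα : ∀ z, q (α z) = 1) (hqβ : ∀ b, q (β (ofAdd b)) = ofAdd (χ b)) :
    Nat.card (crossSub α β χ) = Nat.card Q * Nat.card (kerClosure β χ) := by
  let f : crossSub α β χ →* Q := (MonoidHom.snd Q Q).comp (crossSub α β χ).subtype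
  have hf : Function.Surjective f := fun g => by
    obtain ⟨h, hh⟩ := exists_mem_crossSub hgen hχ g
    exact ⟨⟨_, swap_mem_crossSub hh⟩, rfl⟩
  have e : f.ker ≃ kerClosure β χ :=
    { toFun := fun x => ⟨x.1.1.1, mem_kerClosure_of_mem_crossSub hχ p q hpα hpβ hqα hqβ (by
        have h1 : x.1.1.2 = 1 := x.2
        have := x.1.2
        rwa [← Prod.mk.eta (p := x.1.1), h1] at this)⟩
      invFun := fun k => ⟨⟨(k.1, 1), kerClosure_le_comap_inl hgen hχ k.2⟩, rfl⟩
      left_inv := by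
        rintro ⟨⟨⟨x, y⟩, hx⟩, h1⟩
        have h1 : y = 1 := h1
        subst h1
        rfl
      right_inv := fun k => rfl }
  rw [Subgroup.card_eq_card_quotient_mul_card_subgroup f.ker, Nat.card_congr e,
    Nat.card_congr (QuotientGroup.quotientKerEquivOfSurjective f hf).toEquiv]

end Cross

/-! ### One step of the recursion -/

section Step

open Multiplicative

namespace Wr

variable {Q : Type*} [Group Q]

/-- The base group of the wreath product. -/
def pair : Q × Q →* Wr Q where
  toFun x := ⟨fun t => cond t x.2 x.1, false⟩
  map_one' := by ext t <;> simp
  map_mul' x y := by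
    ext t
    · cases t <;> rfl
    · rfl

@[simp] theorem pair_left_false (x : Q × Q) : (pair x).left false = x.1 := rfl

@[simp] theorem pair_left_true (x : Q × Q) : (pair x).left true = x.2 := rfl

@[simp] theorem pair_flip (x : Q × Q) : (pair x).flip = false := rfl

/-- The automorphism that exchanges the two copies if `z ≠ 0`. -/
def top (z : ZMod 2) : Wr Q := ⟨1, decide (z ≠ 0)⟩

@[simp] theorem top_left (z : ZMod 2) (t : Bool) : (top z : Wr Q).left t = 1 := rfl

@[simp] theorem top_flip (z : ZMod 2) : (top z : Wr Q).flip = decide (z ≠ 0) := rfl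

theorem top_conj_pair (x : Q × Q) : top 1 * pair x * top 1 = pair x.swap := by
  ext t
  · cases t <;> simp [top, pair]
  · simp [top, pair]

end Wr

variable {Q Q' V : Type*} [Group Q] [Group Q'] [AddCommGroup V] [Module (ZMod 2) V]
  (α : Multiplicative (ZMod 2) →* Q) (β : Multiplicative V →* Q)
  (α' : Multiplicative (ZMod 2) →* Q') (β' : Multiplicative V →* Q')
  (ι : Q →* Wr Q') (χ₀ χ : Module.Dual (ZMod 2) V)

/-- The group `Q` with its generators embeds into `Q' ≀ C_2` by `b = ⟨χ₀(b), b⟩`. -/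
structure IsStep : Prop where
  gen : α.range ⊔ β.range = ⊤
  gen' : α'.range ⊔ β'.range = ⊤
  ne_zero : χ₀ ≠ 0
  inj : Function.Injective ι
  map_α : ∀ z, ι (α (ofAdd z)) = Wr.top z
  map_β : ∀ b, ι (β (ofAdd b)) = Wr.pair (α' (ofAdd (χ₀ b)), β' (ofAdd b))

variable {α β α' β' χ₀ χ ι}

namespace IsStep

/-- The pairs of sections stay in the subgroup because it is invariant under exchanging coordinates,
which is all that a flip does. -/
theorem left_mem (h : IsStep α β α' β' ι χ₀) (g : Q) :
    ((ι g).left false, (ι g).left true) ∈ crossSub α' β' χ₀ := by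
  let P : Subgroup Q :=
    { carrier := {g | ((ι g).left false, (ι g).left true) ∈ crossSub α' β' χ₀}
      one_mem' := by simp only [Set.mem_ofPred_eq, map_one]; exact one_mem _
      mul_mem' := by
        intro x y hx hy
        simp only [Set.mem_ofPred_eq, map_mul, Wr.mul_left] at *
        cases (ι y).flip
        · exact mul_mem hx hy
        · exact mul_mem (swap_mem_crossSub hx) hy
      inv_mem' := by
        intro x hx
        simp only [Set.mem_ofPred_eq, map_inv, Wr.inv_left] at *
        cases (ι x).flip
        · exact inv_mem hx
        · exact inv_mem (swap_mem_crossSub hx) }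
  have : P = ⊤ := by
    apply eq_top_of_range_sup_eq_top h.gen
    · show ((ι _).left false, (ι _).left true) ∈ crossSub α' β' χ₀
      rw [h.map_α]; exact one_mem _
    · intro b
      show ((ι _).left false, (ι _).left true) ∈ crossSub α' β' χ₀
      rw [h.map_β]; exact mem_crossSub_left b
  have hg : g ∈ P := this ▸ Subgroup.mem_top g
  exact hg

theorem conj_top (h : IsStep α β α' β' ι χ₀) {g : Q} {x : Q' × Q'} (hg : ι g = Wr.pair x) :
    ι (α (ofAdd 1) * g * α (ofAdd 1)) = Wr.pair x.swap := by
  rw [map_mul, map_mul, h.map_α, hg, Wr.top_conj_pair]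

theorem exists_eq_pair (h : IsStep α β α' β' ι χ₀) {x : Q' × Q'} (hx : x ∈ crossSub α' β' χ₀) :
    ∃ g, ι g = Wr.pair x := by
  induction hx using Subgroup.closure_induction with
  | mem x hx =>
    rcases hx with ⟨b, rfl⟩ | ⟨b, rfl⟩
    · exact ⟨_, h.map_β b⟩
    · exact ⟨_, h.conj_top (h.map_β b)⟩
  | one => exact ⟨1, by rw [map_one, map_one]⟩
  | mul x y _ _ hx hy =>
    obtain ⟨g, hg⟩ := hx
    obtain ⟨g', hg'⟩ := hy
    exact ⟨g * g', by rw [map_mul, hg, hg', map_mul]⟩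
  | inv x _ hx =>
    obtain ⟨g, hg⟩ := hx
    exact ⟨g⁻¹, by rw [map_inv, hg, map_inv]⟩

theorem card_eq (h : IsStep α β α' β' ι χ₀) :
    Nat.card Q = 2 * Nat.card (crossSub α' β' χ₀) := by
  let f : Q → Bool × crossSub α' β' χ₀ := fun g => ((ι g).flip, ⟨_, h.left_mem g⟩)
  have hf : Function.Bijective f := by
    constructor
    · intro g g' e
      simp only [f, Prod.mk.injEq, Subtype.mk.injEq] at e
      refine h.inj (Wr.ext (funext fun t => ?_) e.1)
      cases t
      · exact e.2.1
      · exact e.2.2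
    · rintro ⟨t, x, hx⟩
      cases t
      · obtain ⟨g, hg⟩ := h.exists_eq_pair hx
        exact ⟨g, by simp [f, hg]⟩
      · obtain ⟨g, hg⟩ := h.exists_eq_pair hx
        exact ⟨α (ofAdd 1) * g, by simp [f, hg, h.map_α]⟩
  rw [Nat.card_congr (Equiv.ofBijective f hf), Nat.card_prod]
  simp

/-- Reducing the sections modulo the normal closure one level down kills every generator `(1, b)`
with `χ₀ b = 0`. -/
theorem kerClosure_le (h : IsStep α β α' β' ι χ₀) {g : Q} (hg : g ∈ kerClosure β χ₀) :
    (ι g).flip = false ∧ ∀ t, (ι g).left t ∈ kerClosure β' χ₀ := by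
  let f : Q →* Wr (Q' ⧸ kerClosure β' χ₀) := (Wr.map (QuotientGroup.mk' _)).comp ι
  have hf : kerClosure β χ₀ ≤ f.ker := le_ker_of_kerClosure f fun b hb => by
    ext t
    · show QuotientGroup.mk' _ ((ι _).left t) = 1
      rw [h.map_β]
      cases t
      · simp [hb]
      · exact mk_kerClosure_of_eq_zero hb
    · show (ι _).flip = false
      rw [h.map_β]; rfl
  have h1 : f g = 1 := hf hg
  refine ⟨congrArg Wr.flip h1, fun t => ?_⟩
  exact (QuotientGroup.eq_one_iff _).mp (congrFun (congrArg Wr.left h1) t)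

/-- The `k` reached in this way form a normal subgroup, as every `g'` is the second section of an
element of `Q` that fixes the first level. It contains the images of `ker χ₀`. -/
theorem exists_mem_kerClosure_snd (h : IsStep α β α' β' ι χ₀) {k : Q'}
    (hk : k ∈ kerClosure β' χ₀) : ∃ g ∈ kerClosure β χ₀, ι g = Wr.pair (1, k) := by
  let X : Subgroup Q' := ((kerClosure β χ₀).map ι).comap (Wr.pair.comp (MonoidHom.inr Q' Q'))
  have hX : X.Normal := by
    refine ⟨fun k hk g' => ?_⟩
    obtain ⟨u, hu, hu'⟩ := hk
    obtain ⟨v, hv⟩ := exists_mem_crossSub h.gen' h.ne_zero g'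
    obtain ⟨g, hg⟩ := h.exists_eq_pair (swap_mem_crossSub hv)
    refine ⟨g * u * g⁻¹, Subgroup.Normal.conj_mem inferInstance u hu g, ?_⟩
    rw [map_mul, map_mul, map_inv, hg, hu', MonoidHom.comp_apply, MonoidHom.comp_apply, ← map_mul,
      ← map_inv, ← map_mul]
    simp
  have hle : kerClosure β' χ₀ ≤ X := by
    apply Subgroup.normalClosure_le_normal
    rintro _ ⟨b, hb, rfl⟩
    exact ⟨_, mem_kerClosure hb, by rw [h.map_β, hb, ofAdd_zero, map_one]; rfl⟩
  exact hle hk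

theorem exists_mem_kerClosure (h : IsStep α β α' β' ι χ₀) {x : Q' × Q'}
    (h1 : x.1 ∈ kerClosure β' χ₀) (h2 : x.2 ∈ kerClosure β' χ₀) :
    ∃ g ∈ kerClosure β χ₀, ι g = Wr.pair x := by
  obtain ⟨u, hu, hu'⟩ := h.exists_mem_kerClosure_snd h1
  obtain ⟨v, hv, hv'⟩ := h.exists_mem_kerClosure_snd h2
  have hα : (α (ofAdd 1))⁻¹ = α (ofAdd 1) := inv_eq_of_mul_eq_one_left (map_ofAdd_mul_self α 1)
  refine ⟨(α (ofAdd 1) * u * α (ofAdd 1)) * v, mul_mem ?_ hv, ?_⟩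
  · have := Subgroup.Normal.conj_mem (inferInstance : (kerClosure β χ₀).Normal) u hu (α (ofAdd 1))
    rwa [hα] at this
  · rw [map_mul, h.conj_top hu', hv', ← map_mul]
    simp

/-- The normal closure splits as a direct square: the second factor is realised directly, the first
by conjugating with `a`. -/
theorem card_kerClosure (h : IsStep α β α' β' ι χ₀) :
    Nat.card (kerClosure β χ₀) = Nat.card (kerClosure β' χ₀) ^ 2 := by
  let f : kerClosure β χ₀ → kerClosure β' χ₀ × kerClosure β' χ₀ := fun g =>
    (⟨_, (h.kerClosure_le g.2).2 false⟩, ⟨_, (h.kerClosure_le g.2).2 true⟩)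
  have hf : Function.Bijective f := by
    constructor
    · rintro ⟨g, hg⟩ ⟨g', hg'⟩ e
      simp only [f, Prod.mk.injEq, Subtype.mk.injEq] at e
      refine Subtype.ext (h.inj (Wr.ext (funext fun t => ?_) ?_))
      · cases t
        · exact e.1
        · exact e.2
      · rw [(h.kerClosure_le hg).1, (h.kerClosure_le hg').1]
    · rintro ⟨⟨x, hx⟩, ⟨y, hy⟩⟩
      obtain ⟨g, hg, e⟩ := h.exists_mem_kerClosure (x := (x, y)) hx hy
      exact ⟨⟨g, hg⟩, by simp [f, e]⟩
  rw [Nat.card_congr (Equiv.ofBijective f hf), Nat.card_prod, sq]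

end IsStep

/-- If `χ` takes the value `1` on an element that acts trivially, then the quotient by the normal
closure of `ker χ` is generated by `a`. -/
theorem index_kerClosure_eq_two (hgen : α.range ⊔ β.range = ⊤)
    (p : Q →* Multiplicative (ZMod 2)) (hpα : ∀ z, p (α z) = z) (hpβ : ∀ b, p (β b) = 1)
    {c : V} (hc : χ c = 1) (hβc : β (ofAdd c) = 1) : (kerClosure β χ).index = 2 := by
  set K := kerClosure β χ with hK
  have hβ : ∀ b, QuotientGroup.mk' K (β (ofAdd b)) = 1 := by
    intro b
    have h01 : χ b = 0 ∨ χ b = 1 := by generalize χ b = z; revert z; decide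
    rcases h01 with hb | hb
    · exact mk_kerClosure_of_eq_zero hb
    · rw [mk_kerClosure_of_eq_one hb hc, hβc, map_one]
  let f : Multiplicative (ZMod 2) →* Q ⧸ K := (QuotientGroup.mk' K).comp α
  let p' : Q ⧸ K →* Multiplicative (ZMod 2) := QuotientGroup.lift K p
    (le_ker_of_kerClosure p fun b _ => hpβ _)
  have hf : Function.Bijective f := by
    constructor
    · exact Function.LeftInverse.injective (g := p') fun z => hpα z
    · intro z
      obtain ⟨g, rfl⟩ := QuotientGroup.mk'_surjective K z
      have := eq_top_of_range_sup_eq_top hgen (f.range.comap (QuotientGroup.mk' K))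
        ⟨ofAdd 1, rfl⟩ (fun b => by rw [Subgroup.mem_comap, hβ]; exact one_mem _)
      have hg : g ∈ f.range.comap (QuotientGroup.mk' K) := this ▸ Subgroup.mem_top g
      exact hg
  rw [Subgroup.index, ← Nat.card_congr (Equiv.ofBijective f hf)]
  simp

/-- `C_2 ≀ C_2` is dihedral of order 8, generated by the flip and one coordinate involution. -/
theorem exists_eq_word_of_wr (x : Wr (Multiplicative (ZMod 2))) :
    ∃ i : Fin 4, ∃ e : Bool,
      x = (Wr.top 1 * Wr.pair (ofAdd 1, 1)) ^ (i : ℕ) * cond e (Wr.top 1) 1 := by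
  have key : ∀ (y z : ZMod 2) (t : Bool), ∃ i : Fin 4, ∃ e : Bool,
      let u : Wr (Multiplicative (ZMod 2)) :=
        (Wr.top 1 * Wr.pair (ofAdd 1, 1)) ^ (i : ℕ) * cond e (Wr.top 1) 1
      y = (u.left false).toAdd ∧ z = (u.left true).toAdd ∧ t = u.flip := by
    decide
  obtain ⟨i, e, h1, h2, h3⟩ := key (x.left false).toAdd (x.left true).toAdd x.flip
  refine ⟨i, e, Wr.ext (funext fun t => ?_) h3⟩
  cases t
  · exact h1
  · exact h2

theorem card_wr_zmod_two : Nat.card (Wr (Multiplicative (ZMod 2))) = 8 := by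
  have e : Wr (Multiplicative (ZMod 2)) ≃ (Bool → ZMod 2) × Bool :=
    { toFun := fun g => (g.left, g.flip)
      invFun := fun x => ⟨x.1, x.2⟩
      left_inv := fun _ => rfl
      right_inv := fun _ => rfl }
  rw [Nat.card_congr e]
  simp

/-- The quotient by the normal closure of `ker χ` is dihedral of order exactly 8: a relation `(ac)^4
= 1` bounds it above, a surjection onto `C_2 ≀ C_2` below. The maps `f`, `f'` are what is needed to
build that surjection from sections. -/
theorem IsStep.index_kerClosure_eq_eight (h : IsStep α β α' β' ι χ₀) (hχ : χ ≠ 0) (hne : χ ≠ χ₀)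
    (f f' : Q' →* Multiplicative (ZMod 2))
    (hf : ∀ b, f (α' (ofAdd (χ₀ b))) * f' (β' (ofAdd b)) = ofAdd (χ b))
    (hfβ : ∀ b, f (β' b) = 1) (hfα : ∀ z, f' (α' z) = 1) : (kerClosure β χ).index = 8 := by
  -- Over `𝔽₂` a non-zero form that vanishes on `ker χ₀` equals `χ₀`. The resulting `c` has a
  -- trivial section at the vertex `0`.
  obtain ⟨c, hc0, hc⟩ : ∃ c, χ₀ c = 0 ∧ χ c = 1 := by
    by_contra! hcon
    have h01 : ∀ z : ZMod 2, z ≠ 1 → z = 0 := by decide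
    obtain ⟨u, hu⟩ := exists_eq_one_of_ne_zero hχ
    have hall : ∀ b, χ₀ b = 0 → χ b = 0 := fun b hb => h01 _ (hcon b hb)
    have hu0 : χ₀ u = 1 := by
      by_contra hu0
      exact hcon u (h01 _ hu0) hu
    apply hne
    ext b
    have hb : χ₀ b = 0 ∨ χ₀ b = 1 := by generalize χ₀ b = z; revert z; decide
    rcases hb with hb | hb
    · rw [hb, hall b hb]
    · have := hall (b - u) (by rw [map_sub, hb, hu0, sub_self])
      rw [map_sub, sub_eq_zero] at this
      rw [hb, this, hu]
  set K := kerClosure β χ with hK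
  -- Mixing the sections sends `b` to `(χ(b), 0)` and `a` to the flip.
  let θ : Q →* Wr (Multiplicative (ZMod 2)) := (Wr.mixHom f f').comp ι
  have hθα : θ (α (ofAdd 1)) = Wr.top 1 := by
    show Wr.mixHom f f' (ι _) = _
    rw [h.map_α]
    ext t
    · simp [Wr.mixHom]
    · rfl
  have hθβ : ∀ b, θ (β (ofAdd b)) = Wr.pair (ofAdd (χ b), 1) := by
    intro b
    show Wr.mixHom f f' (ι _) = _
    rw [h.map_β]
    ext t
    · cases t
      · simp [Wr.mixHom, hf]
      · simp [Wr.mixHom, hfβ, hfα]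
    · rfl
  let θ' : Q ⧸ K →* Wr (Multiplicative (ZMod 2)) := QuotientGroup.lift K θ
    (le_ker_of_kerClosure θ fun b hb => by rw [hθβ, hb]; exact map_one Wr.pair)
  set A := QuotientGroup.mk' K (α (ofAdd 1)) with hA
  set C := QuotientGroup.mk' K (β (ofAdd c)) with hC
  have hA2 : A * A = 1 := by rw [hA, ← map_mul, map_ofAdd_mul_self, map_one]
  have hC2 : C * C = 1 := by rw [hC, ← map_mul, map_ofAdd_mul_self, map_one]
  -- As `c = ⟨1, c⟩`, the square of `a * c` has both sections equal to the involution `c`.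
  have hAC : (A * C) ^ 4 = 1 := by
    rw [hA, hC, ← map_mul, ← map_pow]
    have : (α (ofAdd 1) * β (ofAdd c)) ^ 4 = 1 := by
      apply h.inj
      have hb2 := map_ofAdd_mul_self β' c
      rw [map_pow, map_mul, h.map_α, h.map_β, hc0, ofAdd_zero, map_one, map_one]
      ext t
      · cases t <;> simp [pow_succ, hb2, Wr.top, Wr.pair]
      · simp [pow_succ]
    rw [this, map_one]
  let F : Fin 4 × Bool → Q ⧸ K := fun x => (A * C) ^ (x.1 : ℕ) * cond x.2 A 1
  have hF : Function.Surjective F := by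
    intro z
    have hz4 : ∀ i : ℤ, ∃ j : Fin 4, (A * C) ^ i = (A * C) ^ (j : ℕ) := by
      intro i
      refine ⟨⟨(i % 4).toNat, by omega⟩, ?_⟩
      have h4 : (A * C) ^ (4 : ℤ) = 1 := by exact_mod_cast hAC
      have h5 : (A * C) ^ i = (A * C) ^ (i % 4) := by
        conv_lhs => rw [← Int.mul_ediv_add_emod i 4, zpow_add, zpow_mul, h4, one_zpow, one_mul]
      rw [h5, ← zpow_natCast]
      congr 1
      show i % 4 = ((i % 4).toNat : ℤ)
      omega
    obtain ⟨i, hi⟩ := eq_of_mem_closure_involutions hA2 hC2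
      (mem_closure_quotient_kerClosure h.gen hc z)
    obtain ⟨j, hj⟩ := hz4 i
    rw [hj] at hi
    rcases hi with rfl | rfl
    · exact ⟨(j, false), by simp [F]⟩
    · exact ⟨(j, true), by simp [F]⟩
  have hsurj : Function.Surjective θ' := by
    intro x
    obtain ⟨i, e, rfl⟩ := exists_eq_word_of_wr x
    refine ⟨F (i, e), ?_⟩
    have hθA : θ' A = Wr.top 1 := hθα
    have hθC : θ' C = Wr.pair (ofAdd 1, 1) := by rw [← hc]; exact hθβ c
    simp only [F, map_mul, map_pow, hθA, hθC]
    cases e <;> simp [hθA]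
  have hfin : Finite (Q ⧸ K) := Finite.of_surjective F hF
  have h1 : Nat.card (Q ⧸ K) ≤ 8 := by
    have := Nat.card_le_card_of_surjective F hF
    simpa using this
  have h2 := Nat.card_le_card_of_surjective θ' hsurj
  rw [card_wr_zmod_two] at h2
  exact le_antisymm h1 h2

end Step

/-! ### Sections of tree automorphisms -/

namespace TreeAut

/-- Whether an automorphism exchanges the two maximal subtrees. -/
def rootFlip (g : TreeAut) : Bool := decide (g.toPerm [false] = [true])

/-- The action of the section of `g` at the vertex `x` of the first level. -/
def sectionFun (g : TreeAut) (x : Bool) (v : List Bool) : List Bool := (g.toPerm (x :: v)).tail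

theorem toPerm_singleton (g : TreeAut) (x : Bool) : g.toPerm [x] = [xor x g.rootFlip] := by
  have hl : ∀ x : Bool, g.toPerm [x] = [false] ∨ g.toPerm [x] = [true] := by
    intro x
    have h := length_toPerm g [x]
    obtain ⟨y, hy⟩ := List.length_eq_one_iff.mp h
    rw [hy]
    cases y <;> simp
  have hne : g.toPerm [false] ≠ g.toPerm [true] := fun e => by
    have := g.toPerm.injective e
    simp at this
  unfold rootFlip
  cases x <;> rcases hl false with h0 | h0 <;> rcases hl true with h1 | h1 <;>
    simp_all

theorem toPerm_cons (g : TreeAut) (x : Bool) (v : List Bool) :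
    g.toPerm (x :: v) = xor x g.rootFlip :: g.sectionFun x v := by
  have h1 : g.toPerm [x] <+: g.toPerm (x :: v) :=
    (toPerm_prefix_iff g _ _).2 (by simp)
  rw [toPerm_singleton] at h1
  obtain ⟨t, ht⟩ := h1
  unfold sectionFun
  rw [← ht]
  rfl

theorem sectionFun_inv (g : TreeAut) (x : Bool) (v : List Bool) :
    xor (xor x g.rootFlip) g⁻¹.rootFlip = x ∧
      g⁻¹.sectionFun (xor x g.rootFlip) (g.sectionFun x v) = v := by
  have h : g⁻¹.toPerm (g.toPerm (x :: v)) = x :: v := by rw [map_inv]; simp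
  rw [toPerm_cons, toPerm_cons] at h
  exact List.cons.inj h

/-- The section of an automorphism at a vertex of the first level. -/
def sect (g : TreeAut) (x : Bool) : TreeAut :=
  ⟨{ toFun := g.sectionFun x
     invFun := g⁻¹.sectionFun (xor x g.rootFlip)
     left_inv := fun v => (sectionFun_inv g x v).2
     right_inv := fun v => by
       have h := (sectionFun_inv g⁻¹ (xor x g.rootFlip) v).2
       rwa [inv_inv, (sectionFun_inv g x v).1] at h },
    fun v => by
      have h := length_toPerm g (x :: v)
      rw [toPerm_cons] at h
      simpa using h,
    fun u v => by
      have h := toPerm_prefix_iff g (x :: u) (x :: v)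
      rw [toPerm_cons, toPerm_cons] at h
      simpa [List.cons_prefix_cons] using h⟩

theorem toPerm_cons_eq (g : TreeAut) (x : Bool) (v : List Bool) :
    g.toPerm (x :: v) = xor x g.rootFlip :: (g.sect x).toPerm v := toPerm_cons g x v

theorem rootFlip_eq_of_forall {g : TreeAut} {e : Bool} {k : Bool → TreeAut}
    (h : ∀ x v, g.toPerm (x :: v) = xor x e :: (k x).toPerm v) : g.rootFlip = e := by
  have := h false []
  rw [toPerm_cons_eq] at this
  simpa using (List.cons.inj this).1

theorem sect_eq_of_forall {g : TreeAut} {e : Bool} {k : Bool → TreeAut}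
    (h : ∀ x v, g.toPerm (x :: v) = xor x e :: (k x).toPerm v) (x : Bool) : g.sect x = k x := by
  refine toPerm_injective (Equiv.ext fun v => ?_)
  have := h x v
  rw [toPerm_cons_eq] at this
  exact (List.cons.inj this).2

/-- The decomposition of an automorphism into its sections at the first level. -/
def decomp : TreeAut →* Wr TreeAut where
  toFun g := ⟨g.sect, g.rootFlip⟩
  map_one' := by
    have h : ∀ x v, (1 : TreeAut).toPerm (x :: v) = xor x false :: (1 : TreeAut).toPerm v := by
      intro x v; simp
    exact Wr.ext (funext (sect_eq_of_forall (k := fun _ => 1) h))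
      (rootFlip_eq_of_forall (k := fun _ => 1) h)
  map_mul' g g' := by
    have h : ∀ x v, (g * g').toPerm (x :: v) = xor x (xor g.rootFlip g'.rootFlip) ::
        (g.sect (xor x g'.rootFlip) * g'.sect x).toPerm v := by
      intro x v
      rw [map_mul, Equiv.Perm.mul_apply, toPerm_cons_eq, toPerm_cons_eq, map_mul,
        Equiv.Perm.mul_apply, Bool.xor_comm g.rootFlip, Bool.xor_assoc]
    exact Wr.ext
      (funext (sect_eq_of_forall (k := fun x => g.sect (xor x g'.rootFlip) * g'.sect x) h))
      (rootFlip_eq_of_forall (k := fun x => g.sect (xor x g'.rootFlip) * g'.sect x) h)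

theorem decomp_eq_of_forall {g : TreeAut} {e : Bool} {k : Bool → TreeAut}
    (h : ∀ x v, g.toPerm (x :: v) = xor x e :: (k x).toPerm v) : decomp g = ⟨k, e⟩ :=
  Wr.ext (funext (sect_eq_of_forall h)) (rootFlip_eq_of_forall h)

theorem mem_levelStab_succ {m : ℕ} {g : TreeAut} :
    g ∈ levelStab (m + 1) ↔
      (decomp g).flip = false ∧ ∀ x, (decomp g).left x ∈ levelStab m := by
  show _ ↔ g.rootFlip = false ∧ ∀ x, g.sect x ∈ levelStab m
  constructor
  · intro h
    have h1 := fun x (v : List Bool) (hv : v.length = m) => h (x :: v) (by simp [hv])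
    simp only [toPerm_cons_eq, List.cons.injEq] at h1
    refine ⟨?_, fun x v hv => (h1 x v hv).2⟩
    simpa using (h1 false (List.replicate m false) (by simp)).1
  · rintro ⟨h1, h2⟩ v hv
    cases v with
    | nil => simp at hv
    | cons x v =>
      rw [toPerm_cons_eq, h1, Bool.xor_false, h2 x v (by simpa using hv)]

instance (m : ℕ) : (levelStab m).Normal := by
  refine ⟨fun g hg h v hv => ?_⟩
  rw [map_mul, map_mul, Equiv.Perm.mul_apply, Equiv.Perm.mul_apply,
    hg _ (by rw [length_toPerm, hv]), map_inv]
  simp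

end TreeAut

/-! ### Generators of spinal groups -/

section Generators

open Multiplicative TreeAut

/-- The action of `C_2` by exchanging the two maximal subtrees. -/
def swapHom : Multiplicative (ZMod 2) →* TreeAut where
  toFun c := TreeAut.ofInvolutive (swapFun c.toAdd) (swapFun_involutive _) (length_swapFun _)
    fun _ _ h => swapFun_prefix _ h
  map_one' := by
    refine toPerm_injective (Equiv.ext fun v => ?_)
    show swapFun 0 v = v
    cases v <;> simp [swapFun]
  map_mul' c c' := by
    refine toPerm_injective (Equiv.ext fun v => ?_)
    show swapFun (c.toAdd + c'.toAdd) v = swapFun c.toAdd (swapFun c'.toAdd v)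
    generalize c.toAdd = z
    generalize c'.toAdd = z'
    cases v with
    | nil => rfl
    | cons x v =>
      simp only [swapFun, List.cons.injEq, and_true]
      revert x z z'
      decide

theorem swapFun_add (z z' : ZMod 2) (v : List Bool) :
    swapFun (z + z') v = swapFun z (swapFun z' v) :=
  congrArg (fun g : TreeAut => g.toPerm v) (swapHom.map_mul (ofAdd z) (ofAdd z'))

theorem swapFun_zero (v : List Bool) : swapFun 0 v = v :=
  congrArg (fun g : TreeAut => g.toPerm v) swapHom.map_one

theorem spineFun_add (c c' : ℕ → ZMod 2) (v : List Bool) :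
    spineFun (fun j => c j + c' j) v = spineFun c (spineFun c' v) := by
  induction v generalizing c c' with
  | nil => rfl
  | cons x v ih =>
    cases x
    · simp only [spineFun, swapFun_add]
    · simp only [spineFun, ih]

theorem spineFun_zero (v : List Bool) : spineFun (fun _ => 0) v = v := by
  induction v with
  | nil => rfl
  | cons x v ih =>
    cases x
    · simp only [spineFun, swapFun_zero]
    · simp only [spineFun, ih]

variable {d : ℕ} (ω : ℕ → Module.Dual (ZMod 2) (Fin d → ZMod 2))

/-- The action of the level group. -/
def spineHom : Multiplicative (Fin d → ZMod 2) →* TreeAut where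
  toFun b := spineElt ω b.toAdd
  map_one' := by
    refine toPerm_injective (Equiv.ext fun v => ?_)
    show spineFun (fun j => ω j 0) v = v
    simp only [map_zero, spineFun_zero]
  map_mul' b b' := by
    refine toPerm_injective (Equiv.ext fun v => ?_)
    show spineFun (fun j => ω j (b.toAdd + b'.toAdd)) v = spineFun _ (spineFun _ v)
    simp only [map_add, spineFun_add]

theorem decomp_swapHom (z : ZMod 2) : decomp (swapHom (ofAdd z)) = Wr.top z := by
  refine decomp_eq_of_forall (k := fun _ => 1) fun x v => ?_
  show swapFun z (x :: v) = _
  simp only [swapFun, map_one, Equiv.Perm.one_apply, List.cons.injEq, and_true]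
  revert x z
  decide

theorem decomp_spineHom (b : Fin d → ZMod 2) :
    decomp (spineHom ω (ofAdd b)) =
      Wr.pair (swapHom (ofAdd (ω 0 b)), spineHom (seqShift 1 ω) (ofAdd b)) := by
  refine decomp_eq_of_forall fun x v => ?_
  show spineFun (fun j => ω j b) (x :: v) = _
  cases x <;> rfl

theorem swapHom_mem (z : Multiplicative (ZMod 2)) : swapHom z ∈ spinalGroup ω := by
  have h : ∀ z : ZMod 2, z = 0 ∨ z = 1 := by decide
  rcases h z.toAdd with h | h
  · rw [show z = 1 from h, map_one]; exact one_mem _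
  · rw [show z = ofAdd 1 from h]; exact Subgroup.subset_closure (Or.inl rfl)

theorem spineHom_mem (b : Multiplicative (Fin d → ZMod 2)) : spineHom ω b ∈ spinalGroup ω :=
  Subgroup.subset_closure (Or.inr ⟨b.toAdd, rfl⟩)

theorem decomp_left_mem {g : TreeAut} (hg : g ∈ spinalGroup ω) (x : Bool) :
    (decomp g).left x ∈ spinalGroup (seqShift 1 ω) := by
  induction hg using Subgroup.closure_induction generalizing x with
  | mem g hg =>
    rcases hg with hg | ⟨b, rfl⟩
    · rw [Set.mem_singleton_iff.mp hg, show rootSwap = swapHom (ofAdd 1) from rfl, decomp_swapHom]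
      exact one_mem _
    · rw [show spineElt ω b = spineHom ω (ofAdd b) from rfl, decomp_spineHom]
      cases x
      · exact swapHom_mem _ _
      · exact spineHom_mem _ _
  | one => rw [map_one]; exact one_mem _
  | mul g h _ _ hg hh => rw [map_mul]; exact mul_mem (hg _) (hh _)
  | inv g _ hg => rw [map_inv]; exact inv_mem (hg _)

/-- The decomposition of elements of a spinal group. -/
def spinalDecomp : spinalGroup ω →* Wr (spinalGroup (seqShift 1 ω)) where
  toFun g := ⟨fun x => ⟨_, decomp_left_mem ω g.2 x⟩, (decomp g.1).flip⟩
  map_one' := by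
    ext x
    · simp
    · simp
  map_mul' g h := by
    ext x
    · simp
    · simp

/-- `G_ω mod m`. -/
abbrev SpinalMod (m : ℕ) : Type := spinalGroup ω ⧸ (levelStab m).subgroupOf (spinalGroup ω)

/-- The image of `a` in `G_ω mod m`. -/
def modSwap (m : ℕ) : Multiplicative (ZMod 2) →* SpinalMod ω m :=
  (QuotientGroup.mk' _).comp (swapHom.codRestrict (spinalGroup ω) (swapHom_mem ω))

/-- The image of the level group in `G_ω mod m`. -/
def modSpine (m : ℕ) : Multiplicative (Fin d → ZMod 2) →* SpinalMod ω m :=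
  (QuotientGroup.mk' _).comp ((spineHom ω).codRestrict (spinalGroup ω) (spineHom_mem ω))

theorem mod_gen (m : ℕ) : (modSwap ω m).range ⊔ (modSpine ω m).range = ⊤ := by
  rw [eq_top_iff]
  rintro z -
  obtain ⟨⟨g, hg⟩, rfl⟩ := QuotientGroup.mk'_surjective _ z
  induction hg using Subgroup.closure_induction with
  | mem g hg =>
    rcases hg with hg | ⟨b, rfl⟩
    · obtain rfl := Set.mem_singleton_iff.mp hg
      exact Subgroup.mem_sup_left ⟨ofAdd 1, rfl⟩
    · exact Subgroup.mem_sup_right ⟨ofAdd b, rfl⟩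
  | one => exact one_mem _
  | mul g h hg hh ig ih => exact mul_mem ig ih
  | inv g hg ig => exact inv_mem ig

theorem spinalDecomp_mem_ker (m : ℕ) (g : spinalGroup ω) :
    Wr.map (QuotientGroup.mk' ((levelStab m).subgroupOf (spinalGroup (seqShift 1 ω))))
      (spinalDecomp ω g) = 1 ↔ g ∈ (levelStab (m + 1)).subgroupOf (spinalGroup ω) := by
  rw [Subgroup.mem_subgroupOf, mem_levelStab_succ, Wr.ext_iff, and_comm, funext_iff]
  refine and_congr Iff.rfl (forall_congr' fun x => ?_)
  exact QuotientGroup.eq_one_iff _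

/-- The decomposition of `G_ω mod (m + 1)`. -/
def modDecomp (m : ℕ) : SpinalMod ω (m + 1) →* Wr (SpinalMod (seqShift 1 ω) m) :=
  QuotientGroup.lift _ ((Wr.map (QuotientGroup.mk' _)).comp (spinalDecomp ω))
    fun g hg => (spinalDecomp_mem_ker ω m g).mpr hg

/-- The quotient at level `m + 1` has exactly the right kernel for its sections to live in the
quotient of the shifted group at level `m`, so the abstract step applies. -/
theorem isStep_mod (hω : ω 0 ≠ 0) (m : ℕ) :
    IsStep (modSwap ω (m + 1)) (modSpine ω (m + 1)) (modSwap (seqShift 1 ω) m)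
      (modSpine (seqShift 1 ω) m) (modDecomp ω m) (ω 0) where
  gen := mod_gen _ _
  gen' := mod_gen _ _
  ne_zero := hω
  inj := by
    rw [injective_iff_map_eq_one]
    intro z hz
    obtain ⟨g, rfl⟩ := QuotientGroup.mk'_surjective _ z
    exact (QuotientGroup.eq_one_iff _).mpr ((spinalDecomp_mem_ker ω m g).mp hz)
  map_α z := by
    have h := decomp_swapHom z
    have hf := congrArg Wr.flip h
    refine Wr.ext (funext fun x => ?_) hf
    refine (QuotientGroup.eq_one_iff _).mpr ?_
    rw [Subgroup.mem_subgroupOf]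
    have : (decomp (swapHom (ofAdd z))).left x ∈ levelStab m := by rw [h]; exact one_mem _
    exact this
  map_β b := by
    have h := decomp_spineHom ω b
    have hf := congrArg Wr.flip h
    refine Wr.ext (funext fun x => ?_) hf
    have h1 := congrFun (congrArg Wr.left h) x
    cases x <;> exact congrArg (QuotientGroup.mk' _) (Subtype.ext h1)

theorem subsingleton_spinalMod_zero : Subsingleton (SpinalMod ω 0) := by
  refine ⟨fun x y => ?_⟩
  have h : ∀ z : SpinalMod ω 0, z = 1 := fun z => by
    obtain ⟨g, rfl⟩ := QuotientGroup.mk'_surjective _ z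
    exact (QuotientGroup.eq_one_iff _).mpr (levelStab_zero _)
  rw [h x, h y]

theorem seqShift_ne_zero {ω : ℕ → Module.Dual (ZMod 2) (Fin d → ZMod 2)} (hω : ∀ j, ω j ≠ 0) (n : ℕ)
    (j : ℕ) : seqShift n ω j ≠ 0 := hω _

theorem finite_spinalMod (hω : ∀ j, ω j ≠ 0) (m : ℕ) : Finite (SpinalMod ω m) := by
  induction m generalizing ω with
  | zero => have := subsingleton_spinalMod_zero ω; infer_instance
  | succ m ih =>
    have := ih (seqShift 1 ω) (seqShift_ne_zero hω 1)
    exact Finite.of_injective _ (isStep_mod ω (hω 0) m).inj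

end Generators

/-! ### The orders of the finite quotients -/

section Exponents

open Multiplicative

variable {V : Type*} [AddCommGroup V] [Module (ZMod 2) V]

/-- The span of the letters of a word. -/
def listSpan (L : List (Module.Dual (ZMod 2) V)) : Submodule (ZMod 2) (Module.Dual (ZMod 2) V) :=
  Submodule.span (ZMod 2) {y | y ∈ L}

open Classical in
/-- The binary logarithm of the index of the normal closure of `ker χ` in the quotient of the spinal
group that is determined by the word `L`. -/
noncomputable def kerExp (χ : Module.Dual (ZMod 2) V) : List (Module.Dual (ZMod 2) V) → ℤ
  | [] => 1
  | y :: L => if χ ∈ listSpan (y :: L) then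
      if χ = y then 1 + (if χ ∈ listSpan L then kerExp χ L else 2) else 3
    else 1

open Classical in
/-- The binary logarithm of the order of the quotient of the spinal group that is determined by the
word `L`. -/
noncomputable def cardExp : List (Module.Dual (ZMod 2) V) → ℤ
  | [] => 1
  | x :: L => 1 + 2 * cardExp L - (if x ∈ listSpan L then kerExp x L else 0)

theorem listSpan_nil : listSpan ([] : List (Module.Dual (ZMod 2) V)) = ⊥ := by
  simp [listSpan]

theorem kerExp_of_notMem {χ : Module.Dual (ZMod 2) V} {L : List (Module.Dual (ZMod 2) V)}
    (h : χ ∉ listSpan L) : kerExp χ L = 1 := by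
  cases L with
  | nil => rfl
  | cons y L => rw [kerExp, if_neg h]

/-- Linear duality: a form outside the span of finitely many forms does not vanish on their common
kernel. -/
theorem exists_of_notMem_listSpan {χ : Module.Dual (ZMod 2) V}
    {L : List (Module.Dual (ZMod 2) V)} (h : χ ∉ listSpan L) :
    ∃ c, χ c = 1 ∧ ∀ y ∈ L, y c = 0 := by
  by_contra! hcon
  apply h
  have h01 : ∀ z : ZMod 2, z ≠ 0 → z = 1 := by decide
  have : Finite {y // y ∈ L} := L.finite_toSet
  have := mem_span_of_iInf_ker_le_ker (𝕜 := ZMod 2) (L := fun y : {y // y ∈ L} => y.1) (K := χ)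
    (fun c hc => by
      by_contra h0
      obtain ⟨y, hy, hy'⟩ := hcon c (h01 _ h0)
      simp only [Submodule.mem_iInf] at hc
      exact hy' (hc ⟨y, hy⟩))
  rwa [Subtype.range_coe_subtype] at this

/-! ### From words to the finite quotients of spinal groups -/

variable {d : ℕ} {ω : ℕ → Module.Dual (ZMod 2) (Fin d → ZMod 2)}

/-- The prefix of length `m`. -/
def letters {E : Type*} (ω : ℕ → E) (m : ℕ) : List E := (List.range m).map ω

theorem letters_succ {E : Type*} (ω : ℕ → E) (m : ℕ) :
    letters ω (m + 1) = ω 0 :: letters (seqShift 1 ω) m := by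
  simp [letters, List.range_succ_eq_map, seqShift, Function.comp_def]

theorem exists_parity (hω : ∀ j, ω j ≠ 0) (m : ℕ) :
    ∃ p : SpinalMod ω (m + 1) →* Multiplicative (ZMod 2),
      (∀ z, p (modSwap ω (m + 1) z) = z) ∧ ∀ b, p (modSpine ω (m + 1) b) = 1 := by
  have h := isStep_mod ω (hω 0) m
  refine ⟨Wr.flipHom.comp (modDecomp ω m), fun z => ?_, fun b => ?_⟩
  · have h1 := h.map_α z.toAdd
    rw [MonoidHom.comp_apply]
    refine (congrArg Wr.flipHom h1).trans ?_
    have : ∀ z : ZMod 2, (if decide (z ≠ 0) then (1 : ZMod 2) else 0) = z := by decide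
    exact congrArg ofAdd (this z.toAdd)
  · have h1 := h.map_β b.toAdd
    rw [MonoidHom.comp_apply]
    exact congrArg Wr.flipHom h1

/-- The homomorphism `χ` on the level group extends trivially to `G_ω mod (m + 1)`. -/
def Extends (ω : ℕ → Module.Dual (ZMod 2) (Fin d → ZMod 2)) (m : ℕ)
    (χ : Module.Dual (ZMod 2) (Fin d → ZMod 2)) : Prop :=
  ∃ q : SpinalMod ω (m + 1) →* Multiplicative (ZMod 2),
    (∀ z, q (modSwap ω (m + 1) z) = 1) ∧ ∀ b, q (modSpine ω (m + 1) (ofAdd b)) = ofAdd (χ b)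

/-- The first letter is obtained by multiplying the parities of the two sections. A later letter is
obtained by multiplying the values on both sections of its extension one level down. -/
theorem extends_of_mem_letters (hω : ∀ j, ω j ≠ 0) (m : ℕ)
    {χ : Module.Dual (ZMod 2) (Fin d → ZMod 2)} (hχ : χ ∈ letters ω m) : Extends ω m χ := by
  induction m generalizing ω with
  | zero => simp [letters] at hχ
  | succ m ih =>
    have h := isStep_mod ω (hω 0) (m + 1)
    rw [letters_succ, List.mem_cons] at hχ
    have key : ∀ q : SpinalMod (seqShift 1 ω) (m + 1) →* Multiplicative (ZMod 2),
        (∀ b, q (modSwap _ _ (ofAdd (ω 0 b))) * q (modSpine _ _ (ofAdd b)) = ofAdd (χ b)) →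
        Extends ω (m + 1) χ := by
      intro q hq
      refine ⟨(Wr.prodHom q).comp (modDecomp ω (m + 1)), fun z => ?_, fun b => ?_⟩
      · rw [MonoidHom.comp_apply]
        refine (congrArg (Wr.prodHom q) (h.map_α z.toAdd)).trans ?_
        simp [Wr.prodHom]
      · rw [MonoidHom.comp_apply]
        exact (congrArg (Wr.prodHom q) (h.map_β b)).trans (hq b)
    rcases hχ with rfl | hχ
    · obtain ⟨p, hp, hp'⟩ := exists_parity (seqShift_ne_zero hω 1) m
      exact key p fun b => by rw [hp, hp', mul_one]
    · obtain ⟨q, hq, hq'⟩ := ih (seqShift_ne_zero hω 1) hχ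
      exact key q fun b => by rw [hq, hq', one_mul]

theorem extends_of_mem_listSpan (hω : ∀ j, ω j ≠ 0) (m : ℕ)
    {χ : Module.Dual (ZMod 2) (Fin d → ZMod 2)} (hχ : χ ∈ listSpan (letters ω m)) :
    Extends ω m χ := by
  have h0 : Extends ω m 0 := ⟨1, fun _ => rfl, fun _ => rfl⟩
  induction hχ using Submodule.span_induction with
  | mem χ h => exact extends_of_mem_letters hω m h
  | zero => exact h0
  | add χ ψ _ _ hχ hψ =>
    obtain ⟨q, hq, hq'⟩ := hχ
    obtain ⟨r, hr, hr'⟩ := hψ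
    refine ⟨q * r, fun z => ?_, fun b => ?_⟩
    · rw [MonoidHom.mul_apply, hq, hr, one_mul]
    · rw [MonoidHom.mul_apply, hq', hr']; rfl
  | smul a χ _ hχ =>
    have h01 : ∀ z : ZMod 2, z = 0 ∨ z = 1 := by decide
    rcases h01 a with rfl | rfl
    · rwa [zero_smul]
    · rwa [one_smul]

theorem modSpine_eq_one (hω : ∀ j, ω j ≠ 0) (m : ℕ) {c : Fin d → ZMod 2}
    (hc : ∀ y ∈ letters ω m, y c = 0) : modSpine ω (m + 1) (ofAdd c) = 1 := by
  induction m generalizing ω with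
  | zero =>
    have h := isStep_mod ω (hω 0) 0
    have := subsingleton_spinalMod_zero (seqShift 1 ω)
    apply h.inj
    rw [h.map_β, map_one, ← map_one Wr.pair]
    congr 1
    exact Subsingleton.elim _ _
  | succ m ih =>
    have h := isStep_mod ω (hω 0) (m + 1)
    rw [letters_succ] at hc
    apply h.inj
    rw [h.map_β, map_one, ih (seqShift_ne_zero hω 1) fun y hy => hc y (List.mem_cons_of_mem _ hy),
      hc _ List.mem_cons_self, ofAdd_zero, map_one]
    exact map_one Wr.pair

theorem mem_listSpan_cons {x y : Module.Dual (ZMod 2) V} {L : List (Module.Dual (ZMod 2) V)} :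
    x ∈ listSpan (y :: L) ↔ ∃ ε : ZMod 2, ∃ ψ ∈ listSpan L, x = ε • y + ψ := by
  have : {z | z ∈ y :: L} = insert y {z | z ∈ L} := by ext; simp
  rw [listSpan, this, Submodule.mem_span_insert]
  rfl

theorem index_kerClosure_eq_of_notMem (hω : ∀ j, ω j ≠ 0) (m : ℕ)
    {χ : Module.Dual (ZMod 2) (Fin d → ZMod 2)} (hχ : χ ∉ listSpan (letters ω m)) :
    (kerClosure (modSpine ω (m + 1)) χ).index = 2 := by
  obtain ⟨c, hc, hc'⟩ := exists_of_notMem_listSpan hχ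
  obtain ⟨p, hp, hp'⟩ := exists_parity hω m
  exact index_kerClosure_eq_two (mod_gen _ _) p hp hp' hc (modSpine_eq_one hω m hc')

theorem index_kerClosure_eq_eight_of_ne (hω : ∀ j, ω j ≠ 0) (m : ℕ)
    {χ : Module.Dual (ZMod 2) (Fin d → ZMod 2)} (hχ0 : χ ≠ 0)
    (hχ : χ ∈ listSpan (letters ω (m + 1))) (hne : χ ≠ ω 0) :
    (kerClosure (modSpine ω (m + 2)) χ).index = 8 := by
  rw [letters_succ, mem_listSpan_cons] at hχ
  obtain ⟨ε, ψ, hψ, rfl⟩ := hχ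
  obtain ⟨q, hq, hq'⟩ := extends_of_mem_listSpan (seqShift_ne_zero hω 1) m hψ
  obtain ⟨p, hp, hp'⟩ := exists_parity (seqShift_ne_zero hω 1) m
  have h01 : ∀ z : ZMod 2, z = 0 ∨ z = 1 := by decide
  have h := isStep_mod ω (hω 0) (m + 1)
  -- If the first letter occurs in `χ`, it is recovered as the parity of the first section; the rest
  -- comes from the extension `q` on the second section.
  rcases h01 ε with rfl | rfl
  · refine h.index_kerClosure_eq_eight hχ0 hne 1 q (fun b => ?_) (fun _ => rfl) hq
    rw [MonoidHom.one_apply, one_mul, hq', zero_smul, zero_add]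
  · refine h.index_kerClosure_eq_eight hχ0 hne p q (fun b => ?_) hp' hq
    rw [hp, hq', one_smul]; rfl

theorem card_eq_of_mem (hω : ∀ j, ω j ≠ 0) (m : ℕ)
    (hv : ω 0 ∈ listSpan (letters (seqShift 1 ω) m)) :
    Nat.card (SpinalMod ω (m + 2)) = 2 * (Nat.card (SpinalMod (seqShift 1 ω) (m + 1)) *
      Nat.card (kerClosure (modSpine (seqShift 1 ω) (m + 1)) (ω 0))) := by
  have hfin := finite_spinalMod (seqShift 1 ω) (seqShift_ne_zero hω 1) (m + 1)
  obtain ⟨q, hq, hq'⟩ := extends_of_mem_listSpan (seqShift_ne_zero hω 1) m hv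
  obtain ⟨p, hp, hp'⟩ := exists_parity (seqShift_ne_zero hω 1) m
  rw [(isStep_mod ω (hω 0) (m + 1)).card_eq,
    card_crossSub (mod_gen _ _) (hω 0) p q hp hp' hq hq']

theorem card_eq_of_notMem (hω : ∀ j, ω j ≠ 0) (m : ℕ)
    (hv : ω 0 ∉ listSpan (letters (seqShift 1 ω) m)) :
    Nat.card (SpinalMod ω (m + 2)) = 2 * Nat.card (SpinalMod (seqShift 1 ω) (m + 1)) ^ 2 := by
  obtain ⟨c, hc, hc'⟩ := exists_of_notMem_listSpan hv
  rw [(isStep_mod ω (hω 0) (m + 1)).card_eq, crossSub_eq_top (mod_gen _ _) hc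
    (modSpine_eq_one (seqShift_ne_zero hω 1) m hc'), Subgroup.card_top, Nat.card_prod, sq]

/-- Orders and indices need a joint induction: the order uses the index for the first letter one
step down, and the index for the first letter is an order divided by `|K'|²`. With no letters, the
group is `C_2` and the index is 2. A quotient of depth `m + 1` depends only on the first `m`
letters. -/
theorem card_and_index (hω : ∀ j, ω j ≠ 0) (m : ℕ) :
    (Nat.card (SpinalMod ω (m + 1)) : ℝ) = 2 ^ cardExp (letters ω m) ∧
    ∀ χ : Module.Dual (ZMod 2) (Fin d → ZMod 2), χ ≠ 0 →
      ((kerClosure (modSpine ω (m + 1)) χ).index : ℝ) = 2 ^ kerExp χ (letters ω m) := by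
  induction m generalizing ω with
  | zero =>
    constructor
    · have := subsingleton_spinalMod_zero (seqShift 1 ω)
      rw [(isStep_mod ω (hω 0) 0).card_eq]
      simp [letters, cardExp]
    · intro χ hχ
      have hv : χ ∉ listSpan (letters ω 0) := by simpa [letters, listSpan_nil] using hχ
      rw [index_kerClosure_eq_of_notMem hω 0 hv, kerExp_of_notMem hv]
      norm_num
  | succ m ih =>
    obtain ⟨ih1, ih2⟩ := ih (seqShift_ne_zero hω 1)
    have ih3 := ih2 (ω 0) (hω 0)
    have hfin := finite_spinalMod (seqShift 1 ω) (seqShift_ne_zero hω 1) (m + 1)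
    have hfin' := finite_spinalMod ω hω (m + 2)
    set K' := kerClosure (modSpine (seqShift 1 ω) (m + 1)) (ω 0) with hK'
    have hQ' : (Nat.card K' : ℝ) * K'.index = Nat.card (SpinalMod (seqShift 1 ω) (m + 1)) := by
      exact_mod_cast Subgroup.card_mul_index K'
    have hK'0 : (Nat.card K' : ℝ) ≠ 0 := by exact_mod_cast Nat.card_pos.ne'
    have h2 : (2 : ℝ) ≠ 0 := two_ne_zero
    constructor
    · rw [letters_succ, cardExp]
      by_cases hv : ω 0 ∈ listSpan (letters (seqShift 1 ω) m)
      · rw [if_pos hv, card_eq_of_mem hω m hv, zpow_sub₀ h2, zpow_add₀ h2, two_mul (cardExp _),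
          zpow_add₀ h2,
          ← ih1, ← ih3, zpow_one, ← hQ']
        push_cast
        have : (K'.index : ℝ) ≠ 0 := by rw [ih3]; positivity
        rw [← hQ', ← hK']
        field_simp
      · rw [if_neg hv, card_eq_of_notMem hω m hv, sub_zero, zpow_add₀ h2, two_mul (cardExp _),
          zpow_add₀ h2,
          ← ih1, zpow_one, sq]
        push_cast
        ring
    · intro χ hχ
      by_cases hvis : χ ∈ listSpan (letters ω (m + 1))
      · by_cases hne : χ = ω 0
        · subst hne
          have hQ := Subgroup.card_mul_index (kerClosure (modSpine ω (m + 2)) (ω 0))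
          rw [(isStep_mod ω (hω 0) (m + 1)).card_kerClosure] at hQ
          have hQr : (Nat.card K' : ℝ) ^ 2 * (kerClosure (modSpine ω (m + 2)) (ω 0)).index
            = Nat.card (SpinalMod ω (m + 2)) := by exact_mod_cast hQ
          rw [letters_succ] at hvis ⊢
          rw [kerExp, if_pos hvis, if_pos rfl]
          by_cases hv : ω 0 ∈ listSpan (letters (seqShift 1 ω) m)
          · rw [if_pos hv, zpow_add₀ h2, ← ih3, zpow_one]
            rw [card_eq_of_mem hω m hv] at hQr
            push_cast at hQr
            rw [← hQ', ← hK'] at hQr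
            have h3 : (Nat.card K' : ℝ) ^ 2 ≠ 0 := pow_ne_zero _ hK'0
            apply mul_left_cancel₀ h3
            rw [hQr]
            ring
          · rw [if_neg hv]
            rw [card_eq_of_notMem hω m hv] at hQr
            push_cast at hQr
            -- Here `|Q| = 2|Q'|²` and `K'` has index 2, so the index is `2 · 2² = 8`.
            rw [← hQ', hK', index_kerClosure_eq_of_notMem (seqShift_ne_zero hω 1) m hv,
              ← hK'] at hQr
            have h3 : (Nat.card K' : ℝ) ^ 2 ≠ 0 := pow_ne_zero _ hK'0
            apply mul_left_cancel₀ h3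
            rw [hQr]
            norm_num
            ring
        · rw [index_kerClosure_eq_eight_of_ne hω m hχ hvis hne]
          rw [letters_succ] at hvis ⊢
          rw [kerExp, if_pos hvis, if_neg hne]
          norm_num
      · rw [index_kerClosure_eq_of_notMem hω (m + 1) hvis, kerExp_of_notMem hvis]
        norm_num

theorem cardMod_eq (hω : ∀ j, ω j ≠ 0) (m : ℕ) :
    (TreeAut.cardMod (spinalGroup ω) (m + 1) : ℝ) = 2 ^ cardExp (letters ω m) :=
  (card_and_index hω m).1

end Exponents

/-! ### The orders in terms of syllables -/

section Syllables

theorem syllSum_zero (a : ℕ → ℕ) : syllSum a 0 = 0 := by simp [syllSum]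

theorem syllSum_succ (a : ℕ → ℕ) (k : ℕ) : syllSum a (k + 1) = syllSum a k + a (k + 1) := by
  rw [syllSum, Finset.sum_Icc_succ_top (by omega), syllSum]

theorem IsSyllableForm.strictMono {E : Type*} {ω w : ℕ → E} {a : ℕ → ℕ}
    (h : IsSyllableForm ω w a) : StrictMono (syllSum a) :=
  strictMono_nat_of_lt_succ fun k => by
    have := h.pos (k + 1) (by omega)
    rw [syllSum_succ]; omega

theorem IsSyllableForm.exists_eq {E : Type*} {ω w : ℕ → E} {a : ℕ → ℕ}
    (h : IsSyllableForm ω w a) (i : ℕ) : ∃ l r, r < a (l + 1) ∧ i = syllSum a l + r := by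
  induction i with
  | zero => exact ⟨0, 0, h.pos 1 le_rfl, by simp [syllSum_zero]⟩
  | succ i ih =>
    obtain ⟨l, r, hr, rfl⟩ := ih
    by_cases hr' : r + 1 < a (l + 1)
    · exact ⟨l, r + 1, hr', rfl⟩
    · exact ⟨l + 1, 0, h.pos _ (by omega), by rw [syllSum_succ]; omega⟩

theorem IsSyllableForm.image_eq {E : Type*} {ω w : ℕ → E} {a : ℕ → ℕ}
    (h : IsSyllableForm ω w a) {j k e : ℕ} (h1 : syllSum a k < e) (h2 : e ≤ syllSum a (k + 1)) :
    ω '' {i | syllSum a j ≤ i ∧ i < e} = w '' Set.Ioc j (k + 1) := by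
  have hs := h.strictMono
  ext x
  constructor
  · rintro ⟨i, ⟨hi1, hi2⟩, rfl⟩
    obtain ⟨l, r, hr, rfl⟩ := h.exists_eq i
    rw [h.letter l r hr]
    have h3 : syllSum a j < syllSum a (l + 1) := by rw [syllSum_succ]; omega
    have h4 : syllSum a l < syllSum a (k + 1) := by omega
    exact ⟨l + 1, ⟨hs.lt_iff_lt.mp h3, hs.lt_iff_lt.mp h4⟩, rfl⟩
  · rintro ⟨l, ⟨hl1, hl2⟩, rfl⟩
    obtain ⟨l, rfl⟩ : ∃ l', l = l' + 1 := ⟨l - 1, by omega⟩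
    have h0 := h.letter l 0 (h.pos _ (by omega))
    refine ⟨syllSum a l, ⟨hs.monotone (by omega), ?_⟩, by simpa using h0⟩
    exact (hs.monotone (by omega : l ≤ k)).trans_lt h1

variable {V : Type*} [AddCommGroup V] [Module (ZMod 2) V]

/-- The span of the letters of the syllables number `j + 1, …, k`. -/
def syllSpan (w : ℕ → Module.Dual (ZMod 2) V) (j k : ℕ) :
    Submodule (ZMod 2) (Module.Dual (ZMod 2) V) := Submodule.span (ZMod 2) (w '' Set.Ioc j k)

/-- The innermost copy of `x` starts from 3 or 2, according to whether `x` is visible in `L`, and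
each copy adds 1. The hypothesis on `L` is met when `L` starts with a letter other than `x`. -/
theorem kerExp_replicate_append {x : Module.Dual (ZMod 2) V}
    {L : List (Module.Dual (ZMod 2) V)} (hL : x ∈ listSpan L → kerExp x L = 3) (n : ℕ) :
    (x ∈ listSpan (List.replicate (n + 1) x ++ L)) ∧
    (x ∈ listSpan L → kerExp x (List.replicate (n + 1) x ++ L) = n + 4) ∧
    (x ∉ listSpan L → kerExp x (List.replicate (n + 1) x ++ L) = n + 3) := by
  have hmem : ∀ n, x ∈ listSpan (List.replicate (n + 1) x ++ L) := fun n =>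
    Submodule.subset_span (by simp)
  refine ⟨hmem n, ?_⟩
  induction n with
  | zero =>
    have h0 := hmem 0
    simp only [zero_add, List.replicate_one, List.singleton_append] at h0 ⊢
    constructor
    · intro h; rw [kerExp, if_pos h0, if_pos rfl, if_pos h, hL h]; norm_num
    · intro h; rw [kerExp, if_pos h0, if_pos rfl, if_neg h]; norm_num
  | succ n ih =>
    have h1 := hmem (n + 1)
    rw [List.replicate_succ, List.cons_append] at h1 ⊢
    constructor
    · intro h; rw [kerExp, if_pos h1, if_pos rfl, if_pos (hmem n), ih.1 h]; push_cast; ring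
    · intro h; rw [kerExp, if_pos h1, if_pos rfl, if_pos (hmem n), ih.2 h]; push_cast; ring

-- One syllable of the recursion in closed form. Subtracting 3 makes the particular solution exactly
-- `n` when `x` is visible in `L`.
open Classical in
theorem cardExp_replicate_append {x : Module.Dual (ZMod 2) V}
    {L : List (Module.Dual (ZMod 2) V)} (hL : x ∈ listSpan L → kerExp x L = 3) {n : ℕ}
    (hn : 1 ≤ n) :
    cardExp (List.replicate n x ++ L) - 3 =
      2 ^ n * (cardExp L - 3) + (n + if x ∈ listSpan L then 0 else 2 ^ (n + 1) - 1) := by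
  induction n, hn using Nat.le_induction with
  | base =>
    rw [List.replicate_one, List.singleton_append, cardExp]
    split_ifs with h
    · rw [hL h]; push_cast; ring
    · push_cast; ring
  | succ n hn ih =>
    obtain ⟨n, rfl⟩ : ∃ n', n = n' + 1 := ⟨n - 1, by omega⟩
    obtain ⟨h1, h2, h3⟩ := kerExp_replicate_append hL n
    rw [List.replicate_succ, List.cons_append, cardExp, if_pos h1]
    split_ifs at ih ⊢ with h
    · rw [h2 h]
      push_cast at ih ⊢
      rw [pow_succ]
      linear_combination 2 * ih
    · rw [h3 h]
      push_cast at ih ⊢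
      rw [pow_succ _ (n + 1 + 1), pow_succ _ (n + 1)] at *
      linear_combination 2 * ih

theorem letters_add {E : Type*} (ω : ℕ → E) (p q : ℕ) :
    letters ω (p + q) = letters ω p ++ letters (seqShift p ω) q := by
  simp [letters, List.range_add, seqShift, Function.comp_def, add_comm]

theorem seqShift_seqShift {E : Type*} (ω : ℕ → E) (p q : ℕ) :
    seqShift q (seqShift p ω) = seqShift (p + q) ω := by
  funext j
  simp only [seqShift]
  congr 1
  omega

theorem IsSyllableForm.letters_eq_replicate {E : Type*} {ω w : ℕ → E} {a : ℕ → ℕ}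
    (h : IsSyllableForm ω w a) {l t : ℕ} (ht : t ≤ a (l + 1)) :
    letters (seqShift (syllSum a l) ω) t = List.replicate t (w (l + 1)) := by
  rw [letters, List.eq_replicate_iff]
  refine ⟨by simp, fun y hy => ?_⟩
  simp only [List.mem_map, List.mem_range] at hy
  obtain ⟨r, hr, rfl⟩ := hy
  rw [← h.letter l r (by omega), seqShift, add_comm]

variable {ω w : ℕ → Module.Dual (ZMod 2) V} {a : ℕ → ℕ}

theorem IsSyllableForm.listSpan_letters (h : IsSyllableForm ω w a) {j k t : ℕ} (hjk : j ≤ k)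
    (ht1 : 1 ≤ t) (ht : t ≤ a (k + 1)) :
    listSpan (letters (seqShift (syllSum a j) ω) (syllSum a k - syllSum a j + t)) =
      syllSpan w j (k + 1) := by
  have hs := h.strictMono.monotone hjk
  rw [syllSpan, ← h.image_eq (e := syllSum a k + t) (by omega) (by rw [syllSum_succ]; omega),
    listSpan]
  congr 1
  ext x
  simp only [letters, List.mem_map, List.mem_range, Set.mem_image, Set.mem_ofPred_eq, seqShift]
  constructor
  · rintro ⟨i, hi, rfl⟩
    exact ⟨_, ⟨by omega, by omega⟩, rfl⟩
  · rintro ⟨i, ⟨h1, h2⟩, rfl⟩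
    exact ⟨i - syllSum a j, by omega, by congr 1; omega⟩

theorem IsSyllableForm.w_ne_zero (h : IsSyllableForm ω w a) (hω : ∀ j, ω j ≠ 0) {l : ℕ}
    (hl : 1 ≤ l) : w l ≠ 0 := by
  obtain ⟨l, rfl⟩ : ∃ l', l = l' + 1 := ⟨l - 1, by omega⟩
  rw [← h.letter l 0 (h.pos _ (by omega))]
  exact hω _

open Classical in
/-- The contribution of the syllable number `j` to the order of a finite quotient. -/
noncomputable def syllTerm (w : ℕ → Module.Dual (ZMod 2) V) (a : ℕ → ℕ) (k j : ℕ) : ℤ :=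
  2 ^ syllSum a (j - 1) * (a j + if w j ∈ syllSpan w j (k + 1) then 0 else 2 ^ (a j + 1) - 1)

/-- Syllables are prepended one at a time, starting from the last, possibly incomplete one;
multiplying by `2 ^ syllSum a l` turns the recursion into a sum. -/
theorem IsSyllableForm.cardExp_tail (h : IsSyllableForm ω w a) (hω : ∀ j, ω j ≠ 0) {k t : ℕ}
    (ht1 : 1 ≤ t) (ht : t ≤ a (k + 1)) (i l : ℕ) (hil : l + i = k) :
    2 ^ syllSum a l *
      (cardExp (letters (seqShift (syllSum a l) ω) (syllSum a k - syllSum a l + t)) - 3) =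
      ∑ j ∈ Finset.Icc (l + 1) k, syllTerm w a k j + 2 ^ syllSum a k * (t - 1) := by
  induction i generalizing l with
  | zero =>
    obtain rfl : l = k := by omega
    have hw := h.w_ne_zero hω (show 1 ≤ l + 1 by omega)
    have hnot : w (l + 1) ∉ listSpan ([] : List (Module.Dual (ZMod 2) V)) := by
      simpa [listSpan_nil] using hw
    have := cardExp_replicate_append (x := w (l + 1)) (L := []) (fun h => absurd h hnot) ht1
    rw [if_neg hnot, List.append_nil, cardExp] at this
    -- The tail is empty and `cardExp [] = 1`, so the last block contributes `-2 · 2^t + t + 2^(t+1)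
    -- - 1 = t - 1`.
    rw [Nat.sub_self, zero_add, h.letters_eq_replicate ht, this]
    simp
    ring
  | succ i ih =>
    have hlk : l + 1 ≤ k := by omega
    have hs := h.strictMono.monotone hlk
    have hpos := h.pos (l + 1) (by omega)
    have h1 : syllSum a k - syllSum a l + t =
        a (l + 1) + (syllSum a k - syllSum a (l + 1) + t) := by
      rw [syllSum_succ] at hs ⊢; omega
    set L := letters (seqShift (syllSum a (l + 1)) ω) (syllSum a k - syllSum a (l + 1) + t)
      with hLdef
    have h2 : letters (seqShift (syllSum a l) ω) (syllSum a k - syllSum a l + t) =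
        List.replicate (a (l + 1)) (w (l + 1)) ++ L := by
      rw [h1, letters_add, h.letters_eq_replicate le_rfl, seqShift_seqShift, ← syllSum_succ]
    have hspan : listSpan L = syllSpan w (l + 1) (k + 1) := h.listSpan_letters hlk ht1 ht
    -- The tail starts with the next syllable, whose letter differs, so a visible letter has index 8
    -- there.
    have hL : w (l + 1) ∈ listSpan L → kerExp (w (l + 1)) L = 3 := by
      intro hv
      obtain ⟨r, hr⟩ : ∃ r, syllSum a k - syllSum a (l + 1) + t = r + 1 :=
        ⟨syllSum a k - syllSum a (l + 1) + t - 1, by omega⟩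
      rw [hLdef, hr, letters_succ] at hv ⊢
      have h3 : seqShift (syllSum a (l + 1)) ω 0 = w (l + 1 + 1) := by
        rw [seqShift, zero_add]
        simpa using h.letter (l + 1) 0 (h.pos _ (by omega))
      rw [h3] at hv ⊢
      rw [kerExp, if_pos hv, if_neg (h.ne_succ _ (by omega))]
    have hsum : Finset.Icc (l + 1) k = insert (l + 1) (Finset.Icc (l + 1 + 1) k) := by
      ext j; simp only [Finset.mem_Icc, Finset.mem_insert]; omega
    have ih' := ih (l + 1) (by omega)
    rw [← hLdef] at ih'
    rw [h2, cardExp_replicate_append hL hpos, hsum, Finset.sum_insert (by simp), add_assoc,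
      ← ih', syllTerm, hspan, Nat.add_sub_cancel, syllSum_succ, pow_add]
    push_cast
    ring

theorem IsSyllableForm.cardExp_eq (h : IsSyllableForm ω w a) (hω : ∀ j, ω j ≠ 0) {k t : ℕ}
    (ht1 : 1 ≤ t) (ht : t ≤ a (k + 1)) :
    cardExp (letters ω (syllSum a k + t)) =
      3 + ∑ j ∈ Finset.Icc 1 k, syllTerm w a k j + 2 ^ syllSum a k * (t - 1) := by
  have := h.cardExp_tail hω ht1 ht k 0 (by omega)
  rw [syllSum_zero, pow_zero, one_mul, Nat.sub_zero] at this
  have h0 : seqShift 0 ω = ω := rfl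
  rw [h0] at this
  simp only [zero_add] at this
  linear_combination this

end Syllables

/-! ### The Hausdorff dimension of closed subgroups -/

namespace TreeAut

open MeasureTheory Measure Metric Topology ENNReal Pointwise

/-- The infimum defining the distance ranges over the strictly decreasing radii: being at most
`radius (m + 1)` means being below `radius m`, which forces agreement to depth `m + 1`. -/
theorem dist_le_radius_iff {g h : TreeAut} {m : ℕ} :
    dist g h ≤ radius m ↔ g⁻¹ * h ∈ levelStab m := by
  refine ⟨fun hd => ?_, treeDist_le⟩
  cases m with
  | zero => exact levelStab_zero _
  | succ m =>
    obtain ⟨l, hl, hlt⟩ := exists_of_treeDist_lt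
      (hd.trans_lt (radius_strictAnti (Nat.lt_succ_self m)))
    exact levelStab_anti (radius_strictAnti.lt_iff_gt.mp hlt) hl

theorem radius_le_dist {g h : TreeAut} {m : ℕ} (hm : g⁻¹ * h ∉ levelStab (m + 1)) :
    radius m ≤ dist g h := by
  by_contra! hd
  obtain ⟨l, hl, hlt⟩ := exists_of_treeDist_lt hd
  exact hm (levelStab_anti (radius_strictAnti.lt_iff_gt.mp hlt) hl)

theorem tendsto_radius : Tendsto radius atTop (𝓝 0) := by
  refine squeeze_zero (fun m => (radius_pos m).le) (fun m => ?_)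
    (tendsto_pow_atTop_nhds_zero_of_lt_one (r := (1 / 2 : ℝ)) (by norm_num) (by norm_num))
  unfold radius
  rw [one_div, inv_pow]
  have : m ≤ 2 ^ m - 1 := Nat.le_sub_one_of_lt Nat.lt_two_pow_self
  exact inv_anti₀ (by positivity) (pow_le_pow_right₀ one_le_two this)

/-- The coset of the fixator of a level, as a set. -/
def coset (g : TreeAut) (m : ℕ) : Set TreeAut := {h | g⁻¹ * h ∈ levelStab m}

theorem coset_eq_of_mem {g h : TreeAut} {m : ℕ} (hh : h ∈ coset g m) : coset h m = coset g m := by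
  have hgh : g⁻¹ * h ∈ levelStab m := hh
  ext k
  show h⁻¹ * k ∈ levelStab m ↔ g⁻¹ * k ∈ levelStab m
  have : g⁻¹ * k = (g⁻¹ * h) * (h⁻¹ * k) := by group
  rw [this, Subgroup.mul_mem_cancel_left _ hgh]

theorem isOpen_coset (g : TreeAut) (m : ℕ) : IsOpen (coset g m) := by
  rw [Metric.isOpen_iff]
  intro h hh
  refine ⟨radius m, radius_pos m, fun k hk => ?_⟩
  rw [← coset_eq_of_mem hh]
  rw [mem_ball, dist_comm] at hk
  exact dist_le_radius_iff.mp hk.le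

theorem ediam_coset_le (g : TreeAut) (m : ℕ) :
    ediam (coset g m) ≤ ENNReal.ofReal (radius m) := by
  refine Metric.ediam_le fun x hx y hy => ?_
  rw [edist_dist]
  refine ENNReal.ofReal_le_ofReal (dist_le_radius_iff.mpr ?_)
  rw [← coset_eq_of_mem hx] at hy
  exact hy

theorem toPerm_eq_of_mem_levelStab {g h : TreeAut} {m : ℕ} (hgh : g⁻¹ * h ∈ levelStab m)
    {v : List Bool} (hv : v.length ≤ m) : h.toPerm v = g.toPerm v := by
  have := levelStab_anti hv hgh v rfl
  rw [map_mul, map_inv, Equiv.Perm.mul_apply, Equiv.Perm.inv_eq_iff_eq] at this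
  exact this

instance : CompleteSpace TreeAut := by
  refine Metric.complete_of_cauchySeq_tendsto fun u hu => ?_
  have h1 : ∀ m, ∃ N, ∀ k ≥ N, (u N)⁻¹ * u k ∈ levelStab m := by
    intro m
    obtain ⟨N, hN⟩ := Metric.cauchySeq_iff'.mp hu (radius m) (radius_pos m)
    refine ⟨N, fun k hk => dist_le_radius_iff.mp ?_⟩
    rw [dist_comm]
    exact (hN k hk).le
  choose N hN using h1
  -- A Cauchy sequence is eventually constant on each level, so the limit can be read off vertex by
  -- vertex.
  have hlim : ∀ k v, N v.length ≤ k → (u k).toPerm v = (u (N v.length)).toPerm v :=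
    fun k v hk => toPerm_eq_of_mem_levelStab (hN _ _ hk) le_rfl
  let g : TreeAut := ⟨{
      toFun := fun v => (u (N v.length)).toPerm v
      invFun := fun v => (u (N v.length))⁻¹.toPerm v
      left_inv := fun v => by
        simp only [length_toPerm, map_inv]; simp
      right_inv := fun v => by
        simp only [length_toPerm]; simp [map_inv] },
    fun v => length_toPerm _ v,
    fun x y => by
      show (u (N x.length)).toPerm x <+: (u (N y.length)).toPerm y ↔ _
      rw [← hlim _ x (le_max_left _ (N y.length)), ← hlim _ y (le_max_right (N x.length) _)]
      exact toPerm_prefix_iff _ _ _⟩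
  have hg : ∀ v, g.toPerm v = (u (N v.length)).toPerm v := fun v => rfl
  refine ⟨g, Metric.tendsto_atTop.mpr fun ε hε => ?_⟩
  obtain ⟨m, hm⟩ := ((tendsto_order.mp tendsto_radius).2 ε hε).exists
  refine ⟨N m, fun k hk => lt_of_le_of_lt ?_ hm⟩
  refine dist_le_radius_iff.mpr fun v hv => ?_
  rw [map_mul, Equiv.Perm.mul_apply, map_inv, Equiv.Perm.inv_eq_iff_eq, hg]
  subst hv
  exact (hlim k v hk).symm

variable (G : Subgroup TreeAut)

theorem subset_iUnion_coset (m : ℕ) :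
    closure (G : Set TreeAut) ⊆
      ⋃ c : G ⧸ (levelStab m).subgroupOf G, coset (c.out : G) m := by
  intro h hh
  obtain ⟨g, hg, hd⟩ := Metric.mem_closure_iff.mp hh (radius m) (radius_pos m)
  rw [Set.mem_iUnion]
  refine ⟨QuotientGroup.mk (⟨g, hg⟩ : G), ?_⟩
  set c : G ⧸ (levelStab m).subgroupOf G := QuotientGroup.mk (⟨g, hg⟩ : G)
  have h1 : QuotientGroup.mk c.out = c := Quotient.out_eq' c
  have h2 := QuotientGroup.eq.mp h1
  have h3 : g ∈ coset (c.out : G) m := h2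
  rw [← coset_eq_of_mem h3]
  rw [dist_comm] at hd
  exact dist_le_radius_iff.mp hd.le

variable {G}

theorem finite_of_cardMod_ne_zero {m : ℕ} (h : cardMod G m ≠ 0) :
    Finite (G ⧸ (levelStab m).subgroupOf G) := Nat.finite_of_card_ne_zero h

theorem isCompact_closure (hG : ∀ m, cardMod G m ≠ 0) : IsCompact (closure (G : Set TreeAut)) := by
  rw [isCompact_iff_totallyBounded_isComplete]
  refine ⟨Metric.totallyBounded_iff.mpr fun ε hε => ?_, isClosed_closure.isComplete⟩
  obtain ⟨m, hm⟩ := ((tendsto_order.mp tendsto_radius).2 ε hε).exists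
  have := finite_of_cardMod_ne_zero (hG m)
  refine ⟨Set.range fun c : G ⧸ (levelStab m).subgroupOf G => ((c.out : G) : TreeAut),
    Set.finite_range _, (subset_iUnion_coset G m).trans ?_⟩
  refine Set.iUnion_subset fun c h hh => ?_
  refine Set.mem_biUnion ⟨c, rfl⟩ ?_
  rw [mem_ball, dist_comm]
  exact (dist_le_radius_iff.mpr hh).trans_lt hm

/-- Every set is contained in a coset of comparable diameter. -/
theorem exists_coset_of_ediam_le {s : ℝ} (hs : 0 < s) {m₀ : ℕ} {t : Set TreeAut}
    (ht : ediam t ≤ ENNReal.ofReal (radius m₀)) {ε : ℝ≥0∞} (hε : 0 < ε) :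
    ∃ g m, m₀ ≤ m ∧ t ⊆ coset g m ∧
      ENNReal.ofReal (radius m) ^ s ≤ (⨆ _ : t.Nonempty, ediam t ^ s) + ε := by
  -- A very deep coset costs less than `ε`. It serves for the empty set and for sets lying in a
  -- single coset that deep.
  have hsmall : ∃ m, m₀ ≤ m ∧ ENNReal.ofReal (radius m) ^ s ≤ ε := by
    have h1 : Tendsto (fun m => ENNReal.ofReal (radius m) ^ s) atTop (𝓝 0) := by
      have h2 := ENNReal.tendsto_ofReal tendsto_radius
      rw [ENNReal.ofReal_zero] at h2
      have h3 := h2.ennrpow_const s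
      rwa [ENNReal.zero_rpow_of_pos hs] at h3
    obtain ⟨m, hm, hm'⟩ := (((tendsto_order.mp h1).2 ε hε).and (eventually_ge_atTop m₀)).exists
    exact ⟨m, hm', hm.le⟩
  obtain ⟨m₁, hm₁, hm₁'⟩ := hsmall
  rcases t.eq_empty_or_nonempty with rfl | ⟨g, hg⟩
  · exact ⟨1, m₁, hm₁, Set.empty_subset _, hm₁'.trans le_add_self⟩
  have hm₀ : t ⊆ coset g m₀ := fun h hh => by
    refine dist_le_radius_iff.mp ?_
    have := (Metric.edist_le_ediam_of_mem hg hh).trans ht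
    rwa [edist_dist, ENNReal.ofReal_le_ofReal_iff (radius_pos _).le] at this
  by_cases hall : t ⊆ coset g m₁
  · exact ⟨g, m₁, hm₁, hall, hm₁'.trans le_add_self⟩
  -- At the last level whose coset still contains `t`, two points separate at the next level, so the
  -- diameter is at least `radius m`.
  obtain ⟨m, hm, hm', hm''⟩ : ∃ m, m₀ ≤ m ∧ t ⊆ coset g m ∧ ¬ t ⊆ coset g (m + 1) := by
    by_contra! hcon
    exact hall (Nat.le_induction hm₀ (fun m hm ih => hcon m hm ih) m₁ hm₁)
  refine ⟨g, m, hm, hm', ?_⟩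
  obtain ⟨h, hh, hh'⟩ := Set.not_subset.mp hm''
  have h1 : ENNReal.ofReal (radius m) ≤ ediam t := by
    refine le_trans ?_ (Metric.edist_le_ediam_of_mem hg hh)
    rw [edist_dist]
    exact ENNReal.ofReal_le_ofReal (radius_le_dist hh')
  refine le_add_right (le_trans (ENNReal.rpow_le_rpow h1 hs.le) ?_)
  exact le_iSup (fun _ : t.Nonempty => ediam t ^ s) ⟨g, hg⟩

/-- This is B. H. Neumann's covering lemma, applied to the cosets of `G` cut out by the given ones.
-/
theorem one_le_sum_of_subset_cosets {ι : Type*} (F : Finset ι) (g : ι → TreeAut) (m : ι → ℕ)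
    (hcov : (G : Set TreeAut) ⊆ ⋃ i ∈ F, coset (g i) (m i)) :
    (1 : ℝ) ≤ ∑ i ∈ F, (cardMod G (m i) : ℝ)⁻¹ := by
  classical
  -- Cosets disjoint from `G` have no representative there; dropping them only decreases the sum.
  let F' := F.filter fun i => ∃ h : G, (h : TreeAut) ∈ coset (g i) (m i)
  have hch : ∀ i, ∃ h : G, i ∈ F' → (h : TreeAut) ∈ coset (g i) (m i) := by
    intro i
    by_cases hi : i ∈ F'
    · obtain ⟨h, hh⟩ := (Finset.mem_filter.mp hi).2
      exact ⟨h, fun _ => hh⟩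
    · exact ⟨1, fun h => absurd h hi⟩
  choose h hh using hch
  have hcov' : ⋃ i ∈ F', h i • (((levelStab (m i)).subgroupOf G : Subgroup G) : Set G) =
      Set.univ := by
    rw [Set.eq_univ_iff_forall]
    intro x
    have hx := hcov x.2
    simp only [Set.mem_iUnion, exists_prop] at hx ⊢
    obtain ⟨i, hi, hxi⟩ := hx
    have hi' : i ∈ F' := Finset.mem_filter.mpr ⟨hi, x, hxi⟩
    refine ⟨i, hi', ?_⟩
    rw [← coset_eq_of_mem (hh i hi')] at hxi
    rw [mem_leftCoset_iff]
    exact hxi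
  have h1 : (1 : ℚ) ≤ ∑ i ∈ F', (cardMod G (m i) : ℚ)⁻¹ :=
    Subgroup.one_le_sum_inv_index_of_leftCoset_cover hcov'
  have h2 := (Rat.cast_le (K := ℝ)).mpr h1
  push_cast at h2
  exact h2.trans (Finset.sum_le_sum_of_subset_of_nonneg (Finset.filter_subset _ _)
    fun i _ _ => by positivity)

/-! ### Bounds for the Hausdorff measure of the closure -/

variable [MeasurableSpace TreeAut] [BorelSpace TreeAut]

theorem hausdorffMeasure_closure_le (hG : ∀ m, cardMod G m ≠ 0) {s : ℝ} (hs : 0 ≤ s)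
    (h : ∃ᶠ m in atTop, (cardMod G m : ℝ) * radius m ^ s ≤ 1) :
    μH[s] (closure (G : Set TreeAut)) ≤ 1 := by
  have hfin := fun m => finite_of_cardMod_ne_zero (hG m)
  have hfin' := fun m => Fintype.ofFinite (G ⧸ (levelStab m).subgroupOf G)
  have hr : Tendsto (fun m => ENNReal.ofReal (radius m)) atTop (𝓝 0) := by
    have := ENNReal.tendsto_ofReal tendsto_radius
    rwa [ENNReal.ofReal_zero] at this
  refine (hausdorffMeasure_le_liminf_sum s _ _ hr
    (fun m (c : G ⧸ (levelStab m).subgroupOf G) => coset (c.out : G) m)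
    (Eventually.of_forall fun m c => ediam_coset_le _ m)
    (Eventually.of_forall fun m => subset_iUnion_coset G m)).trans ?_
  refine liminf_le_of_frequently_le' (h.mono fun m hm => ?_)
  calc ∑ c : G ⧸ (levelStab m).subgroupOf G, ediam (coset (c.out : G) m) ^ s
      ≤ ∑ c : G ⧸ (levelStab m).subgroupOf G, ENNReal.ofReal (radius m) ^ s :=
        Finset.sum_le_sum fun c _ => ENNReal.rpow_le_rpow (ediam_coset_le _ m) hs
    _ = ENNReal.ofReal ((cardMod G m : ℝ) * radius m ^ s) := by
        rw [Finset.sum_const, Finset.card_univ, ← Nat.card_eq_fintype_card, nsmul_eq_mul,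
          ENNReal.ofReal_rpow_of_pos (radius_pos m), ENNReal.ofReal_mul (by positivity),
          ENNReal.ofReal_natCast]
        rfl
    _ ≤ 1 := by rw [← ENNReal.ofReal_one]; exact ENNReal.ofReal_le_ofReal hm

/-- Each set of a fine cover is enlarged to an open coset at a summable extra cost, compactness
extracts a finite subcover, and the covering lemma bounds its total from below. -/
theorem one_le_hausdorffMeasure_closure (hG : ∀ m, cardMod G m ≠ 0) {s : ℝ} (hs : 0 < s) {m₀ : ℕ}
    (h : ∀ m, m₀ ≤ m → (cardMod G m : ℝ)⁻¹ ≤ radius m ^ s) :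
    1 ≤ μH[s] (closure (G : Set TreeAut)) := by
  rw [hausdorffMeasure_apply]
  refine le_trans ?_ (le_iSup₂ (ENNReal.ofReal (radius m₀))
    (ENNReal.ofReal_pos.mpr (radius_pos m₀)))
  simp only [le_iInf_iff]
  intro t hst ht
  refine ENNReal.le_of_forall_pos_le_add fun ε hε _ => ?_
  obtain ⟨ε', hε', hsum⟩ := ENNReal.exists_pos_sum_of_countable' (ENNReal.coe_pos.mpr hε).ne' ℕ
  choose g m hm hsub hle using fun n => exists_coset_of_ediam_le hs (ht n) (hε' n)
  obtain ⟨F, hF⟩ := (isCompact_closure hG).elim_finite_subcover (fun n => coset (g n) (m n))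
    (fun n => isOpen_coset _ _) (hst.trans (Set.iUnion_mono hsub))
  have h1 := one_le_sum_of_subset_cosets F g m (subset_closure.trans hF)
  calc (1 : ℝ≥0∞) = ENNReal.ofReal 1 := ENNReal.ofReal_one.symm
    _ ≤ ENNReal.ofReal (∑ n ∈ F, (cardMod G (m n) : ℝ)⁻¹) := ENNReal.ofReal_le_ofReal h1
    _ = ∑ n ∈ F, ENNReal.ofReal (cardMod G (m n) : ℝ)⁻¹ :=
        ENNReal.ofReal_sum_of_nonneg fun n _ => by positivity
    _ ≤ ∑ n ∈ F, ((⨆ _ : (t n).Nonempty, ediam (t n) ^ s) + ε' n) := by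
        refine Finset.sum_le_sum fun n _ => le_trans ?_ (hle n)
        rw [ENNReal.ofReal_rpow_of_pos (radius_pos _)]
        exact ENNReal.ofReal_le_ofReal (h _ (hm n))
    _ ≤ ∑' n, ((⨆ _ : (t n).Nonempty, ediam (t n) ^ s) + ε' n) := ENNReal.sum_le_tsum F
    _ = (∑' n, ⨆ _ : (t n).Nonempty, ediam (t n) ^ s) + ∑' n, ε' n := ENNReal.tsum_add
    _ ≤ _ := add_le_add le_rfl hsum.le

end TreeAut

/-! ### Hausdorff dimension as a lower limit of logarithmic orders -/

namespace TreeAut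

open MeasureTheory Measure Topology

variable {G : Subgroup TreeAut}

theorem radius_rpow (m : ℕ) (s : ℝ) : radius m ^ s = 2 ^ (-(s * (2 ^ m - 1))) := by
  unfold radius
  have h1 : ((2 ^ m - 1 : ℕ) : ℝ) = 2 ^ m - 1 := by
    rw [Nat.cast_sub Nat.one_le_two_pow]; simp
  rw [← Real.rpow_natCast, h1, ← Real.rpow_neg (by norm_num), ← Real.rpow_mul (by norm_num)]
  congr 1
  ring

theorem hausdorffDim_eq (hG : ∀ m, cardMod G m ≠ 0) (hb : ∀ m, cardMod G m ≤ 2 ^ 2 ^ m) :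
    hausdorffDim G =
      ENNReal.ofReal (liminf (fun m : ℕ => Real.logb 2 (cardMod G m : ℝ) / 2 ^ m) atTop) := by
  borelize TreeAut
  set u : ℕ → ℝ := fun m => Real.logb 2 (cardMod G m : ℝ) / 2 ^ m with hu
  have hc1 : ∀ m, (1 : ℝ) ≤ cardMod G m := fun m => by
    exact_mod_cast Nat.one_le_iff_ne_zero.mpr (hG m)
  have hu0 : ∀ m, 0 ≤ u m := fun m =>
    div_nonneg (Real.logb_nonneg (by norm_num) (hc1 m)) (by positivity)
  have hu1 : ∀ m, u m ≤ 1 := fun m => by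
    rw [hu]
    refine div_le_one_of_le₀ ?_ (by positivity)
    rw [Real.logb_le_iff_le_rpow (by norm_num) (by linarith [hc1 m])]
    have := hb m
    have h2 : (cardMod G m : ℝ) ≤ 2 ^ (2 ^ m) := by exact_mod_cast this
    refine h2.trans_eq ?_
    rw [← Real.rpow_natCast 2 (2 ^ m)]
    simp
  have hcard : ∀ m, (cardMod G m : ℝ) = 2 ^ (u m * 2 ^ m) := fun m => by
    rw [hu]
    simp only
    rw [div_mul_cancel₀ _ (by positivity), Real.rpow_logb (by norm_num) (by norm_num)
      (by linarith [hc1 m])]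
  have hbdd : IsBoundedUnder (· ≥ ·) atTop u := isBoundedUnder_of ⟨0, hu0⟩
  have hcob : IsCoboundedUnder (· ≥ ·) atTop u :=
    (isBoundedUnder_of ⟨1, hu1⟩ : IsBoundedUnder (· ≤ ·) atTop u).isCoboundedUnder_ge
  have hl0 : 0 ≤ liminf u atTop := le_liminf_of_le hcob (Eventually.of_forall hu0)
  unfold hausdorffDim
  apply le_antisymm
  · refine le_of_forall_gt fun c hc => ?_
    obtain ⟨r, hr1, hr2⟩ := ENNReal.lt_iff_exists_nnreal_btwn.mp hc
    refine lt_of_le_of_lt ?_ hr2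
    apply dimH_le_of_hausdorffMeasure_ne_top
    have hr : liminf u atTop < r := by
      rwa [ENNReal.ofReal_lt_coe_iff hl0] at hr1
    obtain ⟨q, hq1, hq2⟩ := exists_between hr
    have hq := frequently_lt_of_liminf_lt hcob hq1
    -- The gap between `q` and `r` absorbs the `-1` in the exponent `2^m - 1` of the radius; for the
    -- lower bound this `-1` is harmless.
    have hev : ∀ᶠ m : ℕ in atTop, q * 2 ^ m ≤ r * (2 ^ m - 1) := by
      have : Tendsto (fun m : ℕ => ((r : ℝ) - q) * 2 ^ m) atTop atTop :=
        (tendsto_pow_atTop_atTop_of_one_lt (by norm_num : (1 : ℝ) < 2)).const_mul_atTop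
          (sub_pos.mpr hq2)
      filter_upwards [this.eventually_ge_atTop (r : ℝ)] with m hm
      nlinarith
    refine ne_top_of_le_ne_top ENNReal.one_ne_top
      (hausdorffMeasure_closure_le hG (NNReal.coe_nonneg r) ((hq.and_eventually hev).mono ?_))
    rintro m ⟨h1, h2⟩
    rw [hcard, radius_rpow, ← Real.rpow_add (by norm_num)]
    refine Real.rpow_le_one_of_one_le_of_nonpos (by norm_num) ?_
    have : u m * 2 ^ m ≤ q * 2 ^ m := mul_le_mul_of_nonneg_right h1.le (by positivity)
    linarith
  · refine le_of_forall_lt fun c hc => ?_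
    obtain ⟨r, hr1, hr2⟩ := ENNReal.lt_iff_exists_nnreal_btwn.mp hc
    refine lt_of_lt_of_le hr1 ?_
    have hr : r < liminf u atTop := by
      rw [ENNReal.ofReal, ENNReal.coe_lt_coe] at hr2
      exact (Real.lt_toNNReal_iff_coe_lt).mp hr2
    have hr0 : (0 : ℝ) < r := by
      have : (0 : ENNReal) < r := bot_le.trans_lt hr1
      exact_mod_cast this
    apply le_dimH_of_hausdorffMeasure_ne_zero
    have hev := eventually_lt_of_lt_liminf hr hbdd
    obtain ⟨m₀, hm₀⟩ := eventually_atTop.mp hev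
    refine (zero_lt_one.trans_le (one_le_hausdorffMeasure_closure hG hr0 (m₀ := m₀)
      fun m hm => ?_)).ne'
    rw [hcard, radius_rpow, ← Real.rpow_neg (by norm_num)]
    refine Real.rpow_le_rpow_of_exponent_le (by norm_num) ?_
    have : r * 2 ^ m ≤ u m * 2 ^ m := mul_le_mul_of_nonneg_right (hm₀ m hm).le (by positivity)
    nlinarith

end TreeAut

/-! ### Dimensions of spans of syllables -/

section Dimensions

variable {d : ℕ} {ω w : ℕ → Module.Dual (ZMod 2) (Fin d → ZMod 2)} {a : ℕ → ℕ}

theorem dimMod_mono (ω : ℕ → Module.Dual (ZMod 2) (Fin d → ZMod 2)) : Monotone (dimMod ω) := by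
  intro m m' h
  refine Submodule.finrank_mono (Submodule.span_mono (Set.image_mono fun j hj => ?_))
  exact lt_of_lt_of_le hj h

theorem dimMod_le (ω : ℕ → Module.Dual (ZMod 2) (Fin d → ZMod 2)) (m : ℕ) : dimMod ω m ≤ d := by
  refine (Submodule.finrank_le _).trans ?_
  rw [Subspace.dual_finrank_eq]
  simp

theorem bddAbove_dimMod (ω : ℕ → Module.Dual (ZMod 2) (Fin d → ZMod 2)) :
    BddAbove (Set.range (dimMod ω)) := ⟨d, by rintro _ ⟨m, rfl⟩; exact dimMod_le ω m⟩

theorem iSup_dimMod_antitone (ω : ℕ → Module.Dual (ZMod 2) (Fin d → ZMod 2)) :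
    Antitone fun l => ⨆ m, dimMod (seqShift l ω) m := by
  refine antitone_nat_of_succ_le fun l => ciSup_le fun m => ?_
  refine le_trans ?_ (le_ciSup (bddAbove_dimMod (seqShift l ω)) (m + 1))
  refine Submodule.finrank_mono (Submodule.span_mono ?_)
  rintro _ ⟨j, hj, rfl⟩
  refine ⟨j + 1, ?_, ?_⟩
  · exact Nat.add_lt_add_right hj 1
  · simp only [seqShift]; congr 1; omega

/-- An antitone sequence of natural numbers is eventually constant, so the lower limit is attained.
-/
theorem exists_iSup_dimMod_eq (ω : ℕ → Module.Dual (ZMod 2) (Fin d → ZMod 2)) :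
    ∃ l₀, ∀ l, l₀ ≤ l → ⨆ m, dimMod (seqShift l ω) m = diminf ω := by
  set D := fun l => ⨆ m, dimMod (seqShift l ω) m with hD
  have hanti : Antitone D := iSup_dimMod_antitone ω
  obtain ⟨l₀, hl₀⟩ : ∃ l₀, ∀ l, l₀ ≤ l → D l₀ = D l := by
    have hne : (Set.range D).Nonempty := ⟨_, 0, rfl⟩
    obtain ⟨l₀, hl₀⟩ := Nat.sInf_mem hne
    refine ⟨l₀, fun l hl => le_antisymm ?_ (hanti hl)⟩
    rw [hl₀]
    exact Nat.sInf_le ⟨l, rfl⟩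
  have hlim : diminf ω = D l₀ := by
    have h1 : D =ᶠ[atTop] fun _ => D l₀ :=
      eventually_atTop.mpr ⟨l₀, fun l hl => (hl₀ l hl).symm⟩
    show liminf D atTop = D l₀
    rw [liminf_congr h1, liminf_const]
  exact ⟨l₀, fun l hl => by rw [hlim, hl₀ l hl]⟩

/-- The dimension of the span of the syllables number `j + 1, …, k`. -/
noncomputable def syllDim (w : ℕ → Module.Dual (ZMod 2) (Fin d → ZMod 2)) (k j : ℕ) : ℕ :=
  Module.finrank (ZMod 2) (syllSpan w j k)

theorem IsSyllableForm.dimMod_eq (h : IsSyllableForm ω w a) {k : ℕ} (hk : 1 ≤ k) (l : ℕ) :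
    dimMod (seqShift (syllSum a l) ω) (syllSum a k + 1 - syllSum a l) = syllDim w k l := by
  obtain ⟨k, rfl⟩ : ∃ k', k = k' + 1 := ⟨k - 1, by omega⟩
  rw [dimMod, syllDim, syllSpan,
    ← h.image_eq (e := syllSum a (k + 1)) (h.strictMono (Nat.lt_succ_self k)) le_rfl]
  have himage : seqShift (syllSum a l) ω '' {j | j + 1 < syllSum a (k + 1) + 1 - syllSum a l} =
      ω '' {i | syllSum a l ≤ i ∧ i < syllSum a (k + 1)} := by
    ext x
    constructor
    · rintro ⟨i, hi, rfl⟩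
      have hi' : i + 1 < syllSum a (k + 1) + 1 - syllSum a l := hi
      exact ⟨i + syllSum a l, ⟨by omega, by omega⟩, rfl⟩
    · rintro ⟨i, ⟨h1, h2⟩, rfl⟩
      refine ⟨i - syllSum a l, ?_, ?_⟩
      · show i - syllSum a l + 1 < syllSum a (k + 1) + 1 - syllSum a l
        omega
      · simp only [seqShift]; congr 1; omega
  rw [himage]

theorem syllDim_antitone (w : ℕ → Module.Dual (ZMod 2) (Fin d → ZMod 2)) (k : ℕ) :
    Antitone (syllDim w k) := fun _ _ h =>
  Submodule.finrank_mono (Submodule.span_mono (Set.image_mono (Set.Ioc_subset_Ioc_left h)))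

theorem syllSpan_eq_sup {j k : ℕ} (hjk : j < k) :
    syllSpan w j k = syllSpan w (j + 1) k ⊔ Submodule.span (ZMod 2) {w (j + 1)} := by
  have : Set.Ioc j k = Set.Ioc (j + 1) k ∪ {j + 1} := by
    ext i; simp only [Set.mem_Ioc, Set.mem_union, Set.mem_singleton_iff]; omega
  rw [syllSpan, this, Set.image_union, Set.image_singleton, Submodule.span_union, syllSpan]

theorem syllDim_of_mem {j k : ℕ} (hjk : j < k) (h : w (j + 1) ∈ syllSpan w (j + 1) k) :
    syllDim w k j = syllDim w k (j + 1) := by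
  rw [syllDim, syllSpan_eq_sup hjk,
    sup_eq_left.mpr ((Submodule.span_singleton_le_iff_mem _ _).mpr h), syllDim]

theorem syllDim_of_notMem {j k : ℕ} (hjk : j < k) (h : w (j + 1) ∉ syllSpan w (j + 1) k) :
    syllDim w k j = syllDim w k (j + 1) + 1 := by
  rw [syllDim, syllSpan_eq_sup hjk, Submodule.finrank_sup_span_singleton h, syllDim]

theorem syllSpan_self (k : ℕ) : syllSpan w k k = ⊥ := by simp [syllSpan]

theorem syllDim_self (k : ℕ) : syllDim w k k = 0 := by
  rw [syllDim, syllSpan_self, finrank_bot]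

theorem IsSyllableForm.notMem_self (h : IsSyllableForm ω w a) (hω : ∀ j, ω j ≠ 0) {k : ℕ}
    (hk : 1 ≤ k) : w k ∉ syllSpan w k k := by
  rw [syllSpan_self, Submodule.mem_bot]
  exact h.w_ne_zero hω hk

/-- Distinct non-zero vectors over `𝔽₂` are linearly independent, so the letter before the last
syllable is always a drop of the dimension. -/
theorem IsSyllableForm.notMem_succ (h : IsSyllableForm ω w a) (hω : ∀ j, ω j ≠ 0) {k : ℕ}
    (hk : 1 ≤ k) : w k ∉ syllSpan w k (k + 1) := by
  rw [syllSpan_eq_sup (Nat.lt_succ_self k), syllSpan_self, bot_sup_eq,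
    Submodule.mem_span_singleton]
  rintro ⟨z, hz⟩
  have h01 : ∀ z : ZMod 2, z = 0 ∨ z = 1 := by decide
  rcases h01 z with rfl | rfl
  · rw [zero_smul] at hz
    exact h.w_ne_zero hω hk hz.symm
  · rw [one_smul] at hz
    exact h.ne_succ k hk hz.symm

theorem IsSyllableForm.syllDim_pred (h : IsSyllableForm ω w a) (hω : ∀ j, ω j ≠ 0) (k : ℕ) :
    syllDim w (k + 1) k = 1 := by
  rw [syllDim_of_notMem (Nat.lt_succ_self k) (h.notMem_self hω (by omega)), syllDim_self]

theorem IsSyllableForm.syllDim_pred_pred (h : IsSyllableForm ω w a) (hω : ∀ j, ω j ≠ 0) (k : ℕ) :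
    syllDim w (k + 2) k = 2 := by
  rw [syllDim_of_notMem (by omega) (h.notMem_succ hω (by omega)), h.syllDim_pred hω]

theorem IsSyllableForm.lam_eq (h : IsSyllableForm ω w a) {k : ℕ} (hk : 1 ≤ k) (i : ℕ) :
    lam ω a i k = sInf {l | syllDim w k l = i} := by
  unfold lam
  congr 1
  ext l
  rw [Set.mem_ofPred_eq, Set.mem_ofPred_eq, h.dimMod_eq hk]

/-- The smallest `l` at which the dimension is `i` is a place where the dimension drops. -/
theorem exists_syllDim_eq {k J i : ℕ} (hi : i < syllDim w k J) :
    syllDim w k (sInf {l | syllDim w k l = i}) = i ∧ J < sInf {l | syllDim w k l = i} ∧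
      w (sInf {l | syllDim w k l = i}) ∉ syllSpan w (sInf {l | syllDim w k l = i}) k := by
  classical
  have hanti := syllDim_antitone w k
  have hex : ∃ l, syllDim w k l ≤ i := ⟨k, by rw [syllDim_self]; exact Nat.zero_le _⟩
  set l := Nat.find hex with hl
  have hl1 : syllDim w k l ≤ i := Nat.find_spec hex
  have hl2 : ∀ l' < l, i < syllDim w k l' := fun l' h => not_le.mp (Nat.find_min hex h)
  have hJl : J < l := by
    by_contra! hcon
    exact absurd (hanti hcon) (by omega)
  obtain ⟨j, hj⟩ : ∃ j, l = j + 1 := ⟨l - 1, by omega⟩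
  have hjk : j < k := by
    by_contra! hcon
    have := hl2 j (by omega)
    have := hanti hcon
    rw [syllDim_self] at this
    omega
  have hj2 := hl2 j (by omega)
  have hnot : w (j + 1) ∉ syllSpan w (j + 1) k := fun hmem => by
    rw [syllDim_of_mem hjk hmem, ← hj] at hj2
    omega
  have hdim := syllDim_of_notMem hjk hnot
  rw [← hj] at hdim hnot
  have hli : syllDim w k l = i := by omega
  have hInf : sInf {l | syllDim w k l = i} = l := by
    refine le_antisymm (csInf_le (OrderBot.bddBelow _) hli) ?_
    refine le_csInf ⟨l, hli⟩ fun l' hl' => ?_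
    by_contra! hcon
    exact absurd hl' (hl2 l' hcon).ne'
  rw [hInf]
  exact ⟨hli, hJl, hnot⟩

theorem sInf_syllDim_eq {k j : ℕ} (hj1 : 1 ≤ j) (hjk : j ≤ k) (hnot : w j ∉ syllSpan w j k) :
    sInf {l | syllDim w k l = syllDim w k j} = j := by
  obtain ⟨j, rfl⟩ : ∃ j', j = j' + 1 := ⟨j - 1, by omega⟩
  refine le_antisymm (csInf_le (OrderBot.bddBelow _) rfl) ?_
  refine le_csInf ⟨j + 1, rfl⟩ fun l hl => ?_
  by_contra! hcon
  have h1 := syllDim_of_notMem (show j < k by omega) hnot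
  have h2 := syllDim_antitone w k (show l ≤ j by omega)
  have h3 : syllDim w k l = syllDim w k (j + 1) := hl
  omega

/-- Beyond `J` all tails have span of the stable dimension, and a finite window starting at `J`
already attains it. -/
theorem IsSyllableForm.exists_stable (h : IsSyllableForm ω w a) :
    ∃ J k₀, 1 ≤ J ∧ J + 2 ≤ k₀ ∧ (∀ k, 1 ≤ k → ∀ j, J ≤ j → syllDim w k j ≤ diminf ω) ∧
      ∀ k, k₀ ≤ k → syllDim w k J = diminf ω := by
  obtain ⟨l₀, hl₀⟩ := exists_iSup_dimMod_eq ω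
  have hid : ∀ k, k ≤ syllSum a k := h.strictMono.id_le
  set J := l₀ + 1 with hJ
  have hle : ∀ k, 1 ≤ k → ∀ j, J ≤ j → syllDim w k j ≤ diminf ω := by
    intro k hk j hj
    rw [← h.dimMod_eq hk, ← hl₀ (syllSum a j) (by have := hid j; omega)]
    exact le_ciSup (bddAbove_dimMod _) _
  obtain ⟨m, hm⟩ : ∃ m, dimMod (seqShift (syllSum a J) ω) m = diminf ω := by
    rw [← hl₀ (syllSum a J) (by have := hid J; omega)]
    exact Nat.sSup_mem (Set.range_nonempty _) (bddAbove_dimMod _)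
  refine ⟨J, J + 2 + m + syllSum a J, by omega, by omega, hle, fun k hk => ?_⟩
  apply le_antisymm (hle k (by omega) J le_rfl)
  rw [← hm, ← h.dimMod_eq (by omega)]
  apply dimMod_mono
  have := hid k
  omega

open Classical in
/-- The sum over the places where the dimension drops, as a sum over dimensions. -/
theorem IsSyllableForm.sum_lam (h : IsSyllableForm ω w a) (hω : ∀ j, ω j ≠ 0) {n J k : ℕ}
    (hJ : 1 ≤ J) (hle : ∀ j, J ≤ j → syllDim w (k + 2) j ≤ n)
    (heq : syllDim w (k + 2) J = n) (T : ℕ → ℝ) :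
    ∑ j ∈ (Finset.Icc (J + 1) k).filter (fun j => w j ∉ syllSpan w j (k + 2)), T j =
      ∑ i ∈ Finset.Icc 2 (n - 1), T (lam ω a i (k + 2)) := by
  have hlam := h.lam_eq (show 1 ≤ k + 2 by omega)
  symm
  refine Finset.sum_nbij' (fun i => lam ω a i (k + 2)) (fun j => syllDim w (k + 2) j) ?_ ?_ ?_ ?_ ?_
  · intro i hi
    rw [Finset.mem_Icc] at hi
    obtain ⟨h1, h2, h3⟩ := exists_syllDim_eq (w := w) (k := k + 2) (J := J) (i := i) (by omega)
    rw [← hlam i] at h1 h2 h3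
    rw [Finset.mem_filter, Finset.mem_Icc]
    -- From `k + 1` on the dimension is at most 1, so a drop with `i ≥ 2` occurs at `k` or earlier.
    refine ⟨⟨h2, ?_⟩, h3⟩
    by_contra! hcon
    have := syllDim_antitone w (k + 2) (show k + 1 ≤ lam ω a i (k + 2) by omega)
    rw [h1, h.syllDim_pred hω (k + 1)] at this
    omega
  · intro j hj
    rw [Finset.mem_filter, Finset.mem_Icc] at hj
    obtain ⟨⟨h1, h2⟩, h3⟩ := hj
    rw [Finset.mem_Icc]
    obtain ⟨j, rfl⟩ : ∃ j', j = j' + 1 := ⟨j - 1, by omega⟩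
    have h4 := syllDim_of_notMem (show j < k + 2 by omega) h3
    have h5 := hle j (by omega)
    have h6 := syllDim_antitone w (k + 2) h2
    rw [h.syllDim_pred_pred hω] at h6
    omega
  · intro i hi
    rw [Finset.mem_Icc] at hi
    have h1 := (exists_syllDim_eq (w := w) (k := k + 2) (J := J) (i := i) (by omega)).1
    rw [← hlam i] at h1
    exact h1
  · intro j hj
    rw [Finset.mem_filter, Finset.mem_Icc] at hj
    obtain ⟨⟨h1, h2⟩, h3⟩ := hj
    show lam ω a _ _ = j
    rw [hlam]
    exact sInf_syllDim_eq (by omega) (by omega) h3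
  · intro i _
    rfl

end Dimensions

/-! ### Lower limits -/

theorem liminf_le_liminf_of_tendsto_sub {f g : ℕ → ℝ} (hf : IsBoundedUnder (· ≥ ·) atTop f)
    (hg : IsCoboundedUnder (· ≥ ·) atTop g)
    (h : Tendsto (fun k => f k - g k) atTop (nhds 0)) : liminf f atTop ≤ liminf g atTop := by
  refine le_of_forall_lt fun c hc => ?_
  obtain ⟨c₁, hc₁, hc₁'⟩ := exists_between hc
  obtain ⟨c₂, hc₂, hc₂'⟩ := exists_between hc₁'
  refine hc₁.trans_le (le_liminf_of_le hg ?_)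
  filter_upwards [eventually_lt_of_lt_liminf hc₂' hf,
    (tendsto_order.mp h).2 (c₂ - c₁) (sub_pos.mpr hc₂)] with k h1 h2
  linarith

/-- The bounds are transferred to `g` as well, since a lower limit in `ℝ` is meaningful only for
bounded functions. -/
theorem liminf_eq_of_tendsto_sub {f g : ℕ → ℝ} {A B : ℝ} (hA : ∀ k, A ≤ f k) (hB : ∀ k, f k ≤ B)
    (h : Tendsto (fun k => f k - g k) atTop (nhds 0)) :
    liminf f atTop = liminf g atTop ∧ IsBoundedUnder (· ≥ ·) atTop g ∧
      IsCoboundedUnder (· ≥ ·) atTop g := by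
  have hf : IsBoundedUnder (· ≥ ·) atTop f := isBoundedUnder_of ⟨A, hA⟩
  have hf' : IsBoundedUnder (· ≤ ·) atTop f := isBoundedUnder_of ⟨B, hB⟩
  have hg : IsBoundedUnder (· ≥ ·) atTop g := by
    refine isBoundedUnder_of_eventually_ge (a := A - 1) ?_
    filter_upwards [(tendsto_order.mp h).2 1 one_pos] with k hk
    linarith [hA k]
  have hg' : IsBoundedUnder (· ≤ ·) atTop g := by
    refine isBoundedUnder_of_eventually_le (a := B + 1) ?_
    filter_upwards [(tendsto_order.mp h).1 (-1) (by norm_num)] with k hk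
    linarith [hB k]
  refine ⟨le_antisymm ?_ ?_, hg, hg'.isCoboundedUnder_ge⟩
  · exact liminf_le_liminf_of_tendsto_sub hf hg'.isCoboundedUnder_ge h
  · refine liminf_le_liminf_of_tendsto_sub hg hf'.isCoboundedUnder_ge ?_
    have := h.neg
    simpa using this

/-- A subsequence can only raise the lower limit; it does not if its values, reindexed by `ψ`,
eventually lie below the whole sequence. -/
theorem liminf_eq_liminf_comp {u : ℕ → ℝ} {A B : ℝ} (hA : ∀ m, A ≤ u m) (hB : ∀ m, u m ≤ B)
    {φ ψ : ℕ → ℕ} (hφ : Tendsto φ atTop atTop) (hψ : Tendsto ψ atTop atTop)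
    (h : ∀ᶠ m in atTop, u (φ (ψ m)) ≤ u m) : liminf u atTop = liminf (u ∘ φ) atTop := by
  have hb : ∀ {ι : Type} (F : Filter ι) (f : ι → ℕ), IsBoundedUnder (· ≥ ·) F (u ∘ f) :=
    fun F f => isBoundedUnder_of ⟨A, fun i => hA _⟩
  have hc : ∀ {ι : Type} (F : Filter ι) [F.NeBot] (f : ι → ℕ),
      IsCoboundedUnder (· ≥ ·) F (u ∘ f) := fun F _ f =>
    (isBoundedUnder_of ⟨B, fun i => hB _⟩ : IsBoundedUnder (· ≤ ·) F (u ∘ f)).isCoboundedUnder_ge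
  apply le_antisymm
  · exact hφ.liminf_le_liminf_comp (hc (map φ atTop) id) (hb atTop id)
  · refine (hψ.liminf_le_liminf_comp (u := u ∘ φ) (hc (map ψ atTop) φ) (hb atTop φ)).trans ?_
    exact liminf_le_liminf h (hb atTop (φ ∘ ψ)) (hc atTop id)

/-! ### The growth of the orders -/

section Growth

variable {d : ℕ} {ω w : ℕ → Module.Dual (ZMod 2) (Fin d → ZMod 2)} {a : ℕ → ℕ}

theorem kerExp_nonneg {V : Type*} [AddCommGroup V] [Module (ZMod 2) V]
    (χ : Module.Dual (ZMod 2) V) (L : List (Module.Dual (ZMod 2) V)) : 0 ≤ kerExp χ L := by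
  induction L with
  | nil => simp [kerExp]
  | cons y L ih =>
    rw [kerExp]
    split_ifs <;> omega

theorem cardExp_lt {V : Type*} [AddCommGroup V] [Module (ZMod 2) V]
    (L : List (Module.Dual (ZMod 2) V)) : cardExp L < 2 ^ (L.length + 1) := by
  induction L with
  | nil => simp [cardExp]
  | cons y L ih =>
    have := kerExp_nonneg y L
    rw [cardExp, List.length_cons, pow_succ]
    split_ifs <;> omega

theorem cardMod_zero : TreeAut.cardMod (spinalGroup ω) 0 = 1 := by
  have := subsingleton_spinalMod_zero ω
  exact Nat.card_unique

theorem cardMod_ne_zero (hω : ∀ j, ω j ≠ 0) (m : ℕ) : TreeAut.cardMod (spinalGroup ω) m ≠ 0 := by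
  have := finite_spinalMod ω hω m
  exact (Nat.card_pos (α := SpinalMod ω m)).ne'

theorem cardMod_le (hω : ∀ j, ω j ≠ 0) (m : ℕ) :
    TreeAut.cardMod (spinalGroup ω) m ≤ 2 ^ 2 ^ m := by
  cases m with
  | zero => rw [cardMod_zero]; norm_num
  | succ m =>
    have h1 := cardMod_eq hω m
    have h2 := cardExp_lt (letters ω m)
    have h3 : (letters ω m).length = m := by simp [letters]
    rw [h3] at h2
    have h4 : (2 : ℝ) ^ cardExp (letters ω m) ≤ 2 ^ ((2 ^ (m + 1) : ℕ) : ℤ) := by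
      refine zpow_le_zpow_right₀ (by norm_num) ?_
      push_cast
      exact h2.le
    rw [← h1, zpow_natCast] at h4
    exact_mod_cast h4

theorem logb_cardMod (hω : ∀ j, ω j ≠ 0) (m : ℕ) :
    Real.logb 2 (TreeAut.cardMod (spinalGroup ω) (m + 1) : ℝ) = cardExp (letters ω m) := by
  rw [cardMod_eq hω, ← Real.rpow_intCast, Real.logb_rpow (by norm_num) (by norm_num)]

theorem syllTerm_nonneg {V : Type*} [AddCommGroup V] [Module (ZMod 2) V]
    (w : ℕ → Module.Dual (ZMod 2) V) (a : ℕ → ℕ) (k j : ℕ) : 0 ≤ syllTerm w a k j := by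
  unfold syllTerm
  have : (1 : ℤ) ≤ 2 ^ (a j + 1) := one_le_pow₀ (by norm_num)
  refine mul_nonneg (by positivity) (add_nonneg (by positivity) ?_)
  split_ifs
  · exact le_rfl
  · omega

/-- The last complete syllable before the final block is always a drop, and its term alone suffices.
-/
theorem IsSyllableForm.two_pow_le_sum (h : IsSyllableForm ω w a) (hω : ∀ j, ω j ≠ 0) (k : ℕ) :
    (2 : ℤ) ^ syllSum a (k + 1) ≤ ∑ j ∈ Finset.Icc 1 (k + 1), syllTerm w a (k + 1) j := by
  refine le_trans ?_ (Finset.single_le_sum (f := fun j => syllTerm w a (k + 1) j)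
    (fun j _ => syllTerm_nonneg w a _ j) (show k + 1 ∈ Finset.Icc 1 (k + 1) by simp))
  simp only [syllTerm]
  rw [if_neg (h.notMem_succ hω (by omega)), Nat.add_sub_cancel, syllSum_succ, pow_add]
  have : (1 : ℤ) ≤ 2 ^ a (k + 1) := one_le_pow₀ (by norm_num)
  refine mul_le_mul_of_nonneg_left ?_ (by positivity)
  rw [pow_succ]
  omega

/-- Within a syllable, the relative growth is nonincreasing. -/
theorem IsSyllableForm.div_two_pow_le (h : IsSyllableForm ω w a) (hω : ∀ j, ω j ≠ 0) {k t : ℕ}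
    (ht1 : 1 ≤ t) (ht : t ≤ a (k + 2)) :
    (cardExp (letters ω (syllSum a (k + 2))) : ℝ) / 2 ^ (syllSum a (k + 2) + 1) ≤
      (cardExp (letters ω (syllSum a (k + 1) + t)) : ℝ) / 2 ^ (syllSum a (k + 1) + t + 1) := by
  have key : ∀ t', t ≤ t' → t' ≤ a (k + 2) →
      (cardExp (letters ω (syllSum a (k + 1) + t')) : ℝ) / 2 ^ (syllSum a (k + 1) + t' + 1) ≤
      (cardExp (letters ω (syllSum a (k + 1) + t)) : ℝ) / 2 ^ (syllSum a (k + 1) + t + 1) := by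
    intro t' ht'
    induction t', ht' using Nat.le_induction with
    | base => exact fun _ => le_rfl
    | succ t' ht' ih =>
      intro ht2
      refine le_trans ?_ (ih (by omega))
      rw [div_le_div_iff₀ (by positivity) (by positivity)]
      have h1 := h.cardExp_eq hω (k := k + 1) (t := t') (by omega)
        (Nat.le_of_succ_le ht2)
      have h2 := h.cardExp_eq hω (k := k + 1) (t := t' + 1) (by omega) ht2
      have h3 := h.two_pow_le_sum hω k
      have h4 : (1 : ℤ) ≤ t' := by omega
      have h5 : cardExp (letters ω (syllSum a (k + 1) + (t' + 1))) ≤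
          2 * cardExp (letters ω (syllSum a (k + 1) + t')) := by
        rw [h1, h2]
        push_cast
        have h6 : (0 : ℤ) ≤ 2 ^ syllSum a (k + 1) := by positivity
        nlinarith
      have h7 : (cardExp (letters ω (syllSum a (k + 1) + (t' + 1))) : ℝ) ≤
          2 * cardExp (letters ω (syllSum a (k + 1) + t')) := by exact_mod_cast h5
      rw [show syllSum a (k + 1) + (t' + 1) + 1 = (syllSum a (k + 1) + t' + 1) + 1 by ring,
        pow_succ _ (syllSum a (k + 1) + t' + 1)]
      have h8 : (0 : ℝ) < 2 ^ (syllSum a (k + 1) + t' + 1) := by positivity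
      nlinarith
  have := key (a (k + 2)) ht le_rfl
  rwa [← syllSum_succ a (k + 1)] at this

open Classical in
theorem syllTerm_cast (k : ℕ) {j : ℕ} (hj : 1 ≤ j) :
    (syllTerm w a k j : ℝ) = 2 ^ syllSum a (j - 1) * a j +
      if w j ∉ syllSpan w j (k + 1) then 2 ^ syllSum a j * (2 - 1 / 2 ^ a j) else 0 := by
  obtain ⟨j, rfl⟩ : ∃ j', j = j' + 1 := ⟨j - 1, by omega⟩
  simp only [syllTerm, Nat.add_sub_cancel]
  split_ifs with h
  · push_cast
    ring
  · rw [syllSum_succ, pow_add]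
    push_cast
    field_simp
    ring

-- The drop at `k + 1` contributes `2 - 2^{-a_{k+1}}` and the final block a defect of `-1`, both
-- scaled by `2^{s_{k+1}}`; together they form the separate term.
open Classical in
theorem IsSyllableForm.cardExp_cast (h : IsSyllableForm ω w a) (hω : ∀ j, ω j ≠ 0) (k : ℕ) :
    (cardExp (letters ω (syllSum a (k + 2))) : ℝ) =
      3 + bigSigma a (k + 2) + 2 ^ syllSum a (k + 1) * (1 - 1 / 2 ^ a (k + 1)) +
      ∑ j ∈ (Finset.Icc 1 k).filter (fun j => w j ∉ syllSpan w j (k + 2)),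
        2 ^ syllSum a j * (2 - 1 / 2 ^ a j) := by
  have h1 := h.cardExp_eq hω (k := k + 1) (t := a (k + 2)) (h.pos _ (by omega)) le_rfl
  rw [← syllSum_succ a (k + 1)] at h1
  have h2 : ∑ j ∈ Finset.Icc 1 (k + 1), (syllTerm w a (k + 1) j : ℝ) =
      ∑ j ∈ Finset.Icc 1 (k + 1), (2 : ℝ) ^ syllSum a (j - 1) * a j +
      ∑ j ∈ (Finset.Icc 1 (k + 1)).filter (fun j => w j ∉ syllSpan w j (k + 2)),
        2 ^ syllSum a j * (2 - 1 / 2 ^ a j) := by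
    rw [Finset.sum_filter, ← Finset.sum_add_distrib]
    exact Finset.sum_congr rfl fun j hj => syllTerm_cast (k + 1) (Finset.mem_Icc.mp hj).1
  have h3 : (Finset.Icc 1 (k + 1)).filter (fun j => w j ∉ syllSpan w j (k + 2)) =
      insert (k + 1) ((Finset.Icc 1 k).filter (fun j => w j ∉ syllSpan w j (k + 2))) := by
    rw [← Finset.insert_Icc_right_eq_Icc_add_one (by omega), Finset.filter_insert,
      if_pos (h.notMem_succ hω (by omega))]
  rw [h3, Finset.sum_insert (by simp)] at h2
  have h4 : (bigSigma a (k + 2) : ℝ) =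
      ∑ j ∈ Finset.Icc 1 (k + 1), (2 : ℝ) ^ syllSum a (j - 1) * a j +
        2 ^ syllSum a (k + 1) * a (k + 2) := by
    rw [bigSigma, Finset.sum_Icc_succ_top (by omega)]
    push_cast
    rfl
  rw [h1]
  push_cast
  rw [h2, h4]
  ring

theorem IsSyllableForm.tendsto_sub (h : IsSyllableForm ω w a) (hω : ∀ j, ω j ≠ 0) :
    Tendsto (fun k => (cardExp (letters ω (syllSum a k)) : ℝ) / 2 ^ (syllSum a k + 1) -
      1 / 2 * dimExpr ω a (diminf ω) k) atTop (nhds 0) := by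
  classical
  obtain ⟨J, k₀, hJ, hJk, hle, heq⟩ := h.exists_stable
  set T : ℕ → ℝ := fun j => 2 ^ syllSum a j * (2 - 1 / 2 ^ a j) with hT
  have hT0 : ∀ j, 0 ≤ T j := fun j => by
    have h1 : (1 : ℝ) / 2 ^ a j ≤ 1 := by
      rw [div_le_one (by positivity)]
      exact one_le_pow₀ (by norm_num)
    exact mul_nonneg (by positivity) (by linarith)
  set C := ∑ j ∈ Finset.Icc 1 J, T j with hC
  -- `R` collects the drops up to `J`; it is at most `C`, independently of `k`, and vanishes after
  -- division by `2^{s_k}`.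
  have hmain : ∀ k, k₀ ≤ k → ∃ R, 0 ≤ R ∧ R ≤ C ∧
      (cardExp (letters ω (syllSum a k)) : ℝ) / 2 ^ (syllSum a k + 1) -
        1 / 2 * dimExpr ω a (diminf ω) k = (3 + R) / 2 * (1 / 2 ^ syllSum a k) := by
    intro k hk
    obtain ⟨k, rfl⟩ : ∃ k', k = k' + 2 := ⟨k - 2, by omega⟩
    refine ⟨∑ j ∈ (Finset.Icc 1 J).filter (fun j => w j ∉ syllSpan w j (k + 2)), T j,
      Finset.sum_nonneg fun j _ => hT0 j,
      Finset.sum_le_sum_of_subset_of_nonneg (Finset.filter_subset _ _) fun j _ _ => hT0 j, ?_⟩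
    have h1 := h.sum_lam hω hJ (k := k) (hle (k + 2) (by omega)) (heq (k + 2) hk) T
    have h2 : Finset.Icc 1 k = Finset.Icc 1 J ∪ Finset.Icc (J + 1) k := by
      ext j; simp only [Finset.mem_Icc, Finset.mem_union]; omega
    have hdisj : Disjoint ((Finset.Icc 1 J).filter (fun j => w j ∉ syllSpan w j (k + 2)))
        ((Finset.Icc (J + 1) k).filter (fun j => w j ∉ syllSpan w j (k + 2))) := by
      refine Finset.disjoint_filter_filter (Finset.disjoint_left.mpr fun j h1 h2 => ?_)
      rw [Finset.mem_Icc] at h1 h2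
      omega
    have hexp := h.cardExp_cast hω k
    rw [h2, Finset.filter_union, Finset.sum_union hdisj] at hexp
    have hexpr : dimExpr ω a (diminf ω) (k + 2) = (bigSigma a (k + 2) : ℝ) / 2 ^ syllSum a (k + 2) +
        1 / 2 ^ syllSum a (k + 2) * ∑ i ∈ Finset.Icc 2 (diminf ω - 1), T (lam ω a i (k + 2)) +
        1 / 2 ^ a (k + 2) * (1 - 1 / 2 ^ a (k + 1)) := rfl
    rw [hexp, hexpr, ← h1]
    change (_ + (∑ j ∈ (Finset.Icc 1 J).filter (fun j => w j ∉ syllSpan w j (k + 2)), T j +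
      ∑ j ∈ (Finset.Icc (J + 1) k).filter (fun j => w j ∉ syllSpan w j (k + 2)), T j)) / _ - _ = _
    generalize ∑ j ∈ (Finset.Icc 1 J).filter (fun j => w j ∉ syllSpan w j (k + 2)), T j = R
    generalize ∑ j ∈ (Finset.Icc (J + 1) k).filter (fun j => w j ∉ syllSpan w j (k + 2)), T j = S
    rw [pow_succ, syllSum_succ a (k + 1), pow_add]
    field_simp
    ring
  have hlim : Tendsto (fun k => (3 + C) / 2 * (1 / 2 : ℝ) ^ k) atTop (nhds 0) := by
    have := (tendsto_pow_atTop_nhds_zero_of_lt_one (r := (1 / 2 : ℝ)) (by norm_num)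
      (by norm_num)).const_mul ((3 + C) / 2)
    simpa using this
  refine squeeze_zero' ?_ ?_ hlim
  · filter_upwards [eventually_ge_atTop k₀] with k hk
    obtain ⟨R, h1, h2, h3⟩ := hmain k hk
    rw [h3]
    positivity
  · filter_upwards [eventually_ge_atTop k₀] with k hk
    obtain ⟨R, h1, h2, h3⟩ := hmain k hk
    rw [h3]
    have h4 : (1 : ℝ) / 2 ^ syllSum a k ≤ (1 / 2) ^ k := by
      rw [one_div_pow]
      exact one_div_le_one_div_of_le (by positivity)
        (pow_le_pow_right₀ (by norm_num) (h.strictMono.id_le k))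
    exact mul_le_mul (by linarith) h4 (by positivity) (by linarith)

theorem IsSyllableForm.liminf_eq (h : IsSyllableForm ω w a) (hω : ∀ j, ω j ≠ 0) :
    liminf (fun m : ℕ => Real.logb 2 (TreeAut.cardMod (spinalGroup ω) m : ℝ) / 2 ^ m) atTop =
      1 / 2 * liminf (fun k : ℕ => dimExpr ω a (diminf ω) k) atTop := by
  set u : ℕ → ℝ := fun m => Real.logb 2 (TreeAut.cardMod (spinalGroup ω) m : ℝ) / 2 ^ m with hu
  have hc1 : ∀ m, (1 : ℝ) ≤ TreeAut.cardMod (spinalGroup ω) m := fun m => by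
    exact_mod_cast Nat.one_le_iff_ne_zero.mpr (cardMod_ne_zero hω m)
  have hu0 : ∀ m, 0 ≤ u m := fun m =>
    div_nonneg (Real.logb_nonneg (by norm_num) (hc1 m)) (by positivity)
  have hus : ∀ m, u (m + 1) = cardExp (letters ω m) / 2 ^ (m + 1) := fun m => by
    rw [hu]; simp only [logb_cardMod hω]
  have hu1 : ∀ m, u m ≤ 1 := fun m => by
    cases m with
    | zero => rw [hu]; simp [cardMod_zero]
    | succ m =>
      rw [hus]
      refine div_le_one_of_le₀ ?_ (by positivity)
      have h2 := cardExp_lt (letters ω m)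
      have h3 : (letters ω m).length = m := by simp [letters]
      rw [h3] at h2
      exact_mod_cast h2.le
  let φ : ℕ → ℕ := fun k => syllSum a k + 1
  have hφ : Tendsto φ atTop atTop :=
    tendsto_atTop_mono (fun k => (h.strictMono.id_le k).trans (Nat.le_succ _)) tendsto_id
  choose l r hr hlr using h.exists_eq
  -- Level `m` sees `m - 1` letters. The last of them has index `m - 2` and lies in syllable `l (m -
  -- 2) + 1`, at whose end the growth is compared.
  let ψ : ℕ → ℕ := fun m => l (m - 2) + 1
  have hψ : Tendsto ψ atTop atTop := by
    refine tendsto_atTop_atTop.mpr fun b => ⟨syllSum a b + 2, fun m hm => ?_⟩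
    have h1 := hlr (m - 2)
    have h2 := hr (m - 2)
    have h3 : syllSum a b < syllSum a (l (m - 2) + 1) := by rw [syllSum_succ]; omega
    exact (h.strictMono.lt_iff_lt.mp h3).le
  have hev : ∀ᶠ m in atTop, u (φ (ψ m)) ≤ u m := by
    filter_upwards [eventually_ge_atTop (syllSum a 1 + 2)] with m hm
    have h1 := hlr (m - 2)
    have h2 := hr (m - 2)
    have h3 : syllSum a 1 < syllSum a (l (m - 2) + 1) := by rw [syllSum_succ _ (l _)]; omega
    have h4 := h.strictMono.lt_iff_lt.mp h3
    obtain ⟨k, hk⟩ : ∃ k, l (m - 2) = k + 1 := ⟨l (m - 2) - 1, by omega⟩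
    have h5 : m = syllSum a (k + 1) + (r (m - 2) + 1) + 1 := by rw [← hk]; omega
    have h6 : φ (ψ m) = syllSum a (k + 2) + 1 := by simp only [φ, ψ, hk]
    rw [hk] at h2
    have h7 := h.div_two_pow_le hω (k := k) (t := r (m - 2) + 1) (by omega) h2
    rw [h6, hus]
    conv_rhs => rw [h5, hus]
    exact h7
  rw [liminf_eq_liminf_comp hu0 hu1 hφ hψ hev]
  have hsub : Tendsto (fun k => (u ∘ φ) k - 1 / 2 * dimExpr ω a (diminf ω) k) atTop (nhds 0) := by
    refine (h.tendsto_sub hω).congr fun k => ?_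
    simp only [Function.comp, φ, hus]
  obtain ⟨h1, h2, h3⟩ := liminf_eq_of_tendsto_sub (fun k => hu0 (φ k)) (fun k => hu1 (φ k)) hsub
  rw [show liminf (u ∘ φ) atTop = _ from h1]
  -- Doubling is monotone and continuous, and boundedness is known for the halved expression; this
  -- moves the factor `1/2` out of the lower limit.
  have hmono : Monotone fun x : ℝ => 2 * x := fun x y hxy => by
    simpa using hxy
  have h4 := hmono.map_liminf_of_continuousAt
    (fun k => 1 / 2 * dimExpr ω a (diminf ω) k) (by fun_prop) h3 h2
  have h5 : ((fun x : ℝ => 2 * x) ∘ fun k => 1 / 2 * dimExpr ω a (diminf ω) k) =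
      fun k => dimExpr ω a (diminf ω) k := by
    funext k
    simp only [Function.comp]
    ring
  rw [h5] at h4
  rw [← h4]
  ring

end Growth

theorem theorem4p4 {d : ℕ} (ω : ℕ → Module.Dual (ZMod 2) (Fin d → ZMod 2))
    (hω : ∀ j, ω j ≠ 0)
    (w : ℕ → Module.Dual (ZMod 2) (Fin d → ZMod 2)) (a : ℕ → ℕ)
    (hsyll : IsSyllableForm ω w a)
    (n : ℕ) (hn : 2 ≤ n) (hdim : diminf ω = n) :
    TreeAut.hausdorffDim (spinalGroup ω) =
        ENNReal.ofReal (1 / 2 * liminf (fun k : ℕ => dimExpr ω a n k) atTop) ∧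
      liminf (fun m : ℕ =>
          Real.logb 2 (TreeAut.cardMod (spinalGroup ω) m : ℝ) / 2 ^ m) atTop =
        1 / 2 * liminf (fun k : ℕ => dimExpr ω a n k) atTop := by
  have h := hsyll.liminf_eq hω
  rw [hdim] at h
  exact ⟨by rw [TreeAut.hausdorffDim_eq (cardMod_ne_zero hω) (cardMod_le hω), h], h⟩
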